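/- Let $X$ be a second-countable compact Hausdorff space, $G$ a countable discrete group, and $P\subseteq G$ a subsemigroup with $e\in P$ and $G=PP^{-1}$. Let $\theta=(\theta_a)_{a\in P}$ be a right action of $P$ on $X$ by continuous injective maps $\theta_a:X\to X$ with open images, so that $\theta_a\theta_b=\theta_{ba}$ and $\theta_e=\mathrm{id}_X$. Let $X\rtimes P$ be the set of all $(x,g)\in X\times G$ for which there are $a,b\in P$ and $y\in X$ with $g=ab^{-1}$ and $\theta_a(x)=\theta_b(y)$; the point $y$ depends only on $(x,g)$ and is denoted by $u(x,g)$. With the relative product topology and the operations $(x,g)(u(x,g),h)=(x,gh)$ and $(x,g)^{-1}=(u(x,g),g^{-1})$ this is an étale groupoid with unit space $X$, range map $(x,g)\mapsto x$ and source map $u$. Let $l^2(X\rtimes P)$ be the Hilbert $C(X)$-module completion of $C_c(X\rtimes P)$ with respect to $(\xi f)(x,g)=\xi(x,g)f(x)$ and $\langle\xi,\eta\rangle(x)=\sum_{g:(x,g)\in X\rtimes P}\overline{\xi(x,g)}\,\eta(x,g)$. For $f\in C_c(X\rtimes P)$ let $\widetilde\pi(f)$ be the adjointable operator on $l^2(X\rtimes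 P)$ with $$(\widetilde\pi(f)\xi)(x,g)=\sum_{h:(x,h)\in X\rtimes P}f(u(x,g),g^{-1}h)\,\xi(x,h)\qquad(\xi\in C_c(X\rtimes P)).$$ The reduced groupoid $C^*$-algebra $C^*_r(X\rtimes P)$ is the $C^*$-algebra generated by $\widetilde\pi(C_c(X\rtimes P))$ in $\mathcal L(l^2(X\rtimes P))$, where $\mathcal L(E)$ denotes the $C^*$-algebra of adjointable operators on a Hilbert module $E$. For $g\in G$ let $X_g=\{x\in X:(x,g)\in X\rtimes P\}$, a clopen set, and regard $C(X_g)$ as the ideal of all functions in $C(X)$ that vanish outside $X_g$. Let $\hat\alpha$ be the partial action of $G$ on $C(X)$ given by the $*$-isomorphisms $\hat\alpha_g:C(X_{g^{-1}})\to C(X_g)$ with $\hat\alpha_g(f)(x)=f(u(x,g))$ for $x\in X_g$. Let $F$ be the Hilbert $C(X)$-module of all $\xi:G\to C(X)$ such that $\xi(g)\in C(X_g)$ for all $g$ and $\sum_{g}|\xi(g)|^2$ converges in $C(X)$, with $(\xi f)(g)=\xi(g)f$ and $\langle\xi,\eta\rangle=\sum_g\xi(g)^*\eta(g)$. The reduced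 partial crossed product $C(X)\rtimes_r^{\hat\alpha}G$ is the $C^*$-algebra generated in $\mathcal L(F)$ by the operators $\tau(f)$ ($f\in C(X)$) and $v_h$ ($h\in G$), where $$(\tau(f)\xi)(g)=\hat\alpha_g(f|_{X_{g^{-1}}})\,\xi(g),\qquad (v_h\xi)(g)=\xi(gh)|_{X_g\cap X_{gh}}\qquad(\xi\in F,\ g\in G),$$ the last function being extended by zero. **Theorem 2.10.** The $C^*$-algebras $C^*_r(X\rtimes P)$ and $C(X)\rtimes_r^{\hat\alpha}G$ are $*$-isomorphic. More precisely, there is a unitary $\Phi:l^2(X\rtimes P)\to F$ of Hilbert $C(X)$-modules, given on $\eta\in C_c(X\rtimes P)$ by $\Phi(\eta)(g)(x)=\eta(x,g)$ for $x\in X_g$ and $\Phi(\eta)(g)(x)=0$ for $x\notin X_g$, such that $T\mapsto\Phi T\Phi^*$ is a $*$-isomorphism from $C^*_r(X\rtimes P)$ onto $C(X)\rtimes_r^{\hat\alpha}G$. -/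

import Mathlib

set_option linter.unusedSectionVars false

open scoped ComplexOrder CompactlySupported

noncomputable section

section HilbertModules

open UniformSpace

variable {A E : Type*} [CStarAlgebra A] [PartialOrder A] [StarOrderedRing A]
  [NormedAddCommGroup E] [NormedSpace ℂ E] [Module A E] [CStarModule A E]

theorem CStarModule.norm_op_smul_le (a : A) (x : E) : ‖a • x‖ ≤ ‖a‖ * ‖x‖ := by
  have h : ‖a • x‖ ^ 2 ≤ (‖a‖ * ‖x‖) ^ 2 := by
    rw [CStarModule.norm_sq_eq A, mul_pow, CStarModule.norm_sq_eq A (x := x)]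
    simp only [CStarModule.inner_op_smul_right, CStarModule.inner_op_smul_left]
    calc ‖a * (inner A x x * star a)‖ ≤ ‖a‖ * (‖inner A x x‖ * ‖star a‖) :=
          (norm_mul_le _ _).trans (by gcongr; exact norm_mul_le _ _)
      _ = ‖a‖ ^ 2 * ‖inner A x x‖ := by rw [norm_star]; ring
  exact (pow_le_pow_iff_left₀ (norm_nonneg _) (by positivity) (by simp)).mp h

theorem CStarModule.uniformContinuousConstSMul : UniformContinuousConstSMul A E where
  uniformContinuous_const_smul a := by
    refine (LipschitzWith.of_dist_le_mul (K := ‖a‖₊) fun x y => ?_).uniformContinuous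
    rw [dist_eq_norm, dist_eq_norm, ← smul_sub]
    exact CStarModule.norm_op_smul_le a (x - y)

theorem CStarModule.completion_inner_coe (x y : E) :
    inner A (x : Completion E) (y : Completion E) = inner A x y :=
  (Completion.isDenseInducing_coe.prodMap Completion.isDenseInducing_coe).extend_eq
    (CStarModule.continuous_inner : Continuous (Function.uncurry (inner A (E := E)))) (x, y)

theorem CStarModule.continuous_completion_inner :
    Continuous (Function.uncurry (inner A (E := Completion E))) := by
  let inner' : E →+ E →+ A :=
    { toFun := fun x => (CStarModule.innerₛₗ (A := A) x).toAddMonoidHom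
      map_zero' := by ext x; exact CStarModule.inner_zero_left
      map_add' := fun x y => by ext z; exact CStarModule.inner_add_left }
  have : Continuous fun p : E × E => inner' p.1 p.2 := CStarModule.continuous_inner
  exact ((Completion.isDenseInducing_toCompl E).extend_Z_bilin
    (Completion.isDenseInducing_toCompl E) this :)

/-- The completion of an inner product module over a C⋆-algebra is a Hilbert C⋆-module: the inner
product and the action of `A` are extended by continuity. -/
instance CStarModule.completion [UniformContinuousConstSMul A E] :
    CStarModule A (Completion E) where
  toInner := Completion.toInner
  inner_add_right {x y z} := by
    have hc := CStarModule.continuous_completion_inner (A := A) (E := E)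
    have hi : ∀ {f g : Completion E × Completion E × Completion E → Completion E},
        Continuous f → Continuous g → Continuous fun p => inner A (f p) (g p) :=
      fun hf hg => hc.comp (hf.prodMk hg)
    refine Completion.induction_on₃ x y z
      (isClosed_eq (hi (by fun_prop) (by fun_prop))
        ((hi (by fun_prop) (by fun_prop)).add (hi (by fun_prop) (by fun_prop)))) fun a b c => ?_
    rw [← Completion.coe_add]
    simp only [CStarModule.completion_inner_coe, CStarModule.inner_add_right]
  inner_self_nonneg {x} := by
    have hc := CStarModule.continuous_completion_inner (A := A) (E := E)
    refine Completion.induction_on x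
      (CStarAlgebra.isClosed_nonneg.preimage (hc.comp (continuous_id.prodMk continuous_id)))
      fun a => ?_
    change (0 : A) ≤ inner A (a : Completion E) (a : Completion E)
    rw [CStarModule.completion_inner_coe]
    exact CStarModule.inner_self_nonneg
  inner_self {x} := by
    have hc := CStarModule.continuous_completion_inner (A := A) (E := E)
    have hn : ‖x‖ = √‖inner A x x‖ := by
      refine Completion.induction_on x (isClosed_eq (by fun_prop)
        ((hc.comp (continuous_id.prodMk continuous_id)).norm.sqrt)) fun a => ?_
      simp only [CStarModule.completion_inner_coe, Completion.norm_coe]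
      exact CStarModule.norm_eq_sqrt_norm_inner_self a
    rw [← norm_eq_zero (a := x), hn, Real.sqrt_eq_zero (norm_nonneg _), norm_eq_zero]
  inner_op_smul_right {a x y} := by
    have hc := CStarModule.continuous_completion_inner (A := A) (E := E)
    refine Completion.induction_on₂ x y (isClosed_eq
      (hc.comp (continuous_fst.prodMk (continuous_snd.const_smul a)))
      (continuous_const.mul hc)) fun x y => ?_
    rw [← Completion.coe_smul]
    simp only [CStarModule.completion_inner_coe, CStarModule.inner_op_smul_right]
  inner_smul_right_complex {z x y} := by
    have hc := CStarModule.continuous_completion_inner (A := A) (E := E)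
    refine Completion.induction_on₂ x y (isClosed_eq
      (hc.comp (continuous_fst.prodMk (continuous_snd.const_smul z)))
      (hc.const_smul z)) fun x y => ?_
    rw [← Completion.coe_smul]
    simp only [CStarModule.completion_inner_coe, CStarModule.inner_smul_right_complex]
  star_inner x y := by
    have hc := CStarModule.continuous_completion_inner (A := A) (E := E)
    refine Completion.induction_on₂ x y (isClosed_eq hc.star
      (hc.comp continuous_swap)) fun x y => ?_
    simp only [CStarModule.completion_inner_coe, CStarModule.star_inner]
  norm_eq_sqrt_norm_inner_self x := by
    have hc := CStarModule.continuous_completion_inner (A := A) (E := E)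
    refine Completion.induction_on x (isClosed_eq (by fun_prop)
      ((hc.comp (continuous_id.prodMk continuous_id)).norm.sqrt)) fun a => ?_
    simp only [CStarModule.completion_inner_coe, Completion.norm_coe]
    exact CStarModule.norm_eq_sqrt_norm_inner_self a

end HilbertModules

section Adjointable

variable (A E : Type*) [CStarAlgebra A] [PartialOrder A] [StarOrderedRing A]
  [NormedAddCommGroup E] [NormedSpace ℂ E] [Module A E] [CStarModule A E]

/-- The algebra `𝓛(E)` of adjointable operators on an inner product module `E` over `A`, with the
operator norm. -/
def adjointableSubalgebra : Subalgebra ℂ (E →L[ℂ] E) where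
  carrier := {T | ∃ S : E →L[ℂ] E, ∀ x y, inner A (T x) y = inner A x (S y)}
  mul_mem' := by
    rintro T₁ T₂ ⟨S₁, h₁⟩ ⟨S₂, h₂⟩
    exact ⟨S₂ * S₁, fun x y => by simp [h₁, h₂]⟩
  add_mem' := by
    rintro T₁ T₂ ⟨S₁, h₁⟩ ⟨S₂, h₂⟩
    exact ⟨S₁ + S₂, fun x y => by simp [h₁, h₂]⟩
  algebraMap_mem' c := by
    refine ⟨star c • 1, fun x y => ?_⟩
    simp [Algebra.algebraMap_eq_smul_one]

/-- The type of adjointable operators on `E`. -/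
def Adjointable : Type _ := adjointableSubalgebra A E

namespace Adjointable

variable {A E}

/-- An adjointable operator from a pair of mutually adjoint operators. -/
def mk (T S : E →L[ℂ] E) (h : ∀ x y, inner A (T x) y = inner A x (S y)) : Adjointable A E :=
  ⟨T, S, h⟩

instance : NormedRing (Adjointable A E) := inferInstanceAs (NormedRing (adjointableSubalgebra A E))

instance : NormedAlgebra ℂ (Adjointable A E) :=
  inferInstanceAs (NormedAlgebra ℂ (adjointableSubalgebra A E))

instance : CoeFun (Adjointable A E) fun _ => E → E := ⟨fun T => T.1⟩

theorem ext_inner {x y : E} (h : ∀ z, inner A z x = inner A z y) : x = y := by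
  rw [← sub_eq_zero, ← CStarModule.inner_self (A := A), CStarModule.inner_sub_right, h, sub_self]

/-- The adjoint operator. -/
instance : Star (Adjointable A E) where
  star T := ⟨T.2.choose, T.1, fun x y => by
    rw [← CStarModule.star_inner, ← T.2.choose_spec, CStarModule.star_inner]⟩

theorem inner_star_right (T : Adjointable A E) (x y : E) :
    inner A x (star T y) = inner A (T x) y :=
  (T.2.choose_spec x y).symm

theorem eq_star {T S : Adjointable A E}
    (h : ∀ x y, inner A (T x) y = inner A x (S y)) : S = star T :=
  Subtype.ext <| ContinuousLinearMap.ext fun y => ext_inner (A := A) fun x => by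
    rw [inner_star_right, h]

theorem inner_star_left (T : Adjointable A E) (x y : E) :
    inner A (star T x) y = inner A x (T y) := by
  rw [← CStarModule.star_inner, inner_star_right, CStarModule.star_inner]

instance : StarRing (Adjointable A E) where
  star_involutive T := (eq_star fun x y => inner_star_left T x y).symm
  star_mul T S := (eq_star fun x y => by
    change inner A (T (S x)) y = inner A x (star S (star T y))
    rw [inner_star_right, inner_star_right]).symm
  star_add T S := (eq_star fun x y => by
    change inner A (T x + S x) y = inner A x (star T y + star S y)
    rw [CStarModule.inner_add_left, CStarModule.inner_add_right, inner_star_right,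
      inner_star_right]).symm

instance : StarModule ℂ (Adjointable A E) where
  star_smul c T := (eq_star fun x y => by
    change inner A (c • T x) y = inner A x (star c • star T y)
    rw [CStarModule.inner_smul_left_complex, CStarModule.inner_smul_right_complex,
      inner_star_right]).symm

instance : CStarRing (Adjointable A E) where
  norm_mul_self_le T := by
    have hb : ∀ x : E, ‖T x‖ ≤ √‖star T * T‖ * ‖x‖ := fun x => by
      have h : ‖T x‖ ^ 2 ≤ (√‖star T * T‖ * ‖x‖) ^ 2 := by
        rw [mul_pow, Real.sq_sqrt (norm_nonneg (star T * T)), CStarModule.norm_sq_eq A,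
            ← inner_star_right]
        calc ‖inner A x (star T (T x))‖ ≤ ‖x‖ * ‖(star T * T) x‖ := CStarModule.norm_inner_le E
          _ ≤ ‖x‖ * (‖star T * T‖ * ‖x‖) := by
            gcongr
            exact (star T * T : Adjointable A E).1.le_opNorm x
          _ = ‖star T * T‖ * ‖x‖ ^ 2 := by ring
      exact (pow_le_pow_iff_left₀ (norm_nonneg _) (by positivity) (by simp)).mp h
    have hT : ‖T‖ ≤ √‖star T * T‖ := T.1.opNorm_le_bound (Real.sqrt_nonneg _) hb
    calc ‖T‖ * ‖T‖ ≤ √‖star T * T‖ * √‖star T * T‖ := by gcongr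
      _ = ‖star T * T‖ := Real.mul_self_sqrt (norm_nonneg _)

/-- The C⋆-subalgebra of `𝓛(E)` generated by a set of operators: the norm closure of the
`*`-algebra that the set generates. -/
def cstarGenerated (s : Set (Adjointable A E)) : NonUnitalStarSubalgebra ℂ (Adjointable A E) :=
  (NonUnitalStarAlgebra.adjoin ℂ s).topologicalClosure

end Adjointable

end Adjointable

/-- A submonoid `P` of a group `G` is a right Ore sub-semigroup of `G` if `G = P P⁻¹`. -/
class IsRightOre {G : Type*} [Group G] (P : Submonoid G) : Prop where
  exists_eq_mul_inv : ∀ g : G, ∃ a b : P, g = a * (b : G)⁻¹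

/-- An injective right action of `P` on `X`: continuous injective maps `θ a : X → X` with
`θ a ∘ θ b = θ (b * a)` and `θ 1 = id`, whose images are open. -/
structure InjectiveAction {G : Type*} [Group G] (P : Submonoid G) (X : Type*)
    [TopologicalSpace X] where
  toFun : P → X → X
  continuous_toFun : ∀ a, Continuous (toFun a)
  injective_toFun : ∀ a, Function.Injective (toFun a)
  toFun_toFun : ∀ a b x, toFun a (toFun b x) = toFun (b * a) x
  toFun_one : ∀ x, toFun 1 x = x
  isOpen_range : ∀ a, IsOpen (Set.range (toFun a))

namespace InjectiveAction

variable {G X : Type*} [Group G] {P : Submonoid G} [TopologicalSpace X]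

instance : CoeFun (InjectiveAction P X) fun _ => P → X → X := ⟨InjectiveAction.toFun⟩

/-- `Q_x`: the set of `g = a b⁻¹`, with `a, b ∈ P`, such that `θ a x = θ b y` for some `y`. -/
def Q (θ : InjectiveAction P X) (x : X) : Set G :=
  {g | ∃ (a b : P) (y : X), g = a * (b : G)⁻¹ ∧ θ a x = θ b y}

/-- The underlying set `{(x, g) : g ∈ Q_x}` of the transformation groupoid `X ⋊ P`. -/
def TransGroupoid (θ : InjectiveAction P X) : Type _ := {p : X × G // p.2 ∈ θ.Q p.1}

variable {θ : InjectiveAction P X}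

theorem apply_eq_of_apply_eq [IsRightOre P] {a b m n : P} {x y : X}
    (h : (a : G) * (b : G)⁻¹ = m * (n : G)⁻¹) (hxy : θ a x = θ b y) : θ m x = θ n y := by
  obtain ⟨p, q, hpq⟩ := IsRightOre.exists_eq_mul_inv (P := P) ((a : G)⁻¹ * m)
  have h1 : (m * q : P) = a * p := by
    apply Subtype.ext
    have : (m : G) = a * (p * (q : G)⁻¹) := by rw [← hpq]; group
    simp [this, mul_assoc]
  have h2 : (n * q : P) = b * p := by
    apply Subtype.ext
    have h3 : (n : G) = b * ((a : G)⁻¹ * m) := by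
      have : (m : G) = a * (b : G)⁻¹ * n := by rw [h]; group
      rw [this]; group
    simp [h3, hpq, mul_assoc]
  apply θ.injective_toFun q
  rw [θ.toFun_toFun, θ.toFun_toFun, h1, h2, ← θ.toFun_toFun, ← θ.toFun_toFun, hxy]

namespace TransGroupoid

/-- The element of `X ⋊ P` given by a pair `(x, g)` with `g ∈ Q_x`. -/
def ofMem (p : X × G) (h : p.2 ∈ θ.Q p.1) : θ.TransGroupoid := ⟨p, h⟩

/-- The range map `r(x, g) = x`, the unit space being identified with `X`. -/
def range (γ : θ.TransGroupoid) : X := γ.1.1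

@[simp] theorem range_ofMem (p : X × G) (h : p.2 ∈ θ.Q p.1) : (ofMem p h).range = p.1 := rfl

/-- The canonical cocycle `c(x, g) = g`. -/
def cocycle (γ : θ.TransGroupoid) : G := γ.1.2

/-- The source map `s(x, g) = u(x, g)`, where `u(x, g)` is the point with
`θ a x = θ b (u(x, g))` whenever `g = a b⁻¹`. -/
def source (γ : θ.TransGroupoid) : X := γ.2.choose_spec.choose_spec.choose

@[ext] theorem ext {γ γ' : θ.TransGroupoid} (h : γ.range = γ'.range)
    (h' : γ.cocycle = γ'.cocycle) : γ = γ' :=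
  Subtype.ext (Prod.ext h h')

section

variable [IsRightOre P]

theorem apply_source (γ : θ.TransGroupoid) {a b : P} (h : γ.cocycle = a * (b : G)⁻¹) :
    θ a γ.range = θ b γ.source := by
  have := γ.2.choose_spec.choose_spec.choose_spec
  exact apply_eq_of_apply_eq (this.1.symm.trans h) this.2

theorem eq_source (γ : θ.TransGroupoid) {a b : P} (h : γ.cocycle = a * (b : G)⁻¹) {y : X}
    (hy : θ a γ.range = θ b y) : γ.source = y :=
  θ.injective_toFun b ((γ.apply_source h).symm.trans hy)

theorem mul_aux (γ γ' : θ.TransGroupoid) (h : γ'.range = γ.source) :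
    ∃ a b : P, γ.cocycle * γ'.cocycle = a * (b : G)⁻¹ ∧ θ a γ.range = θ b γ'.source := by
  obtain ⟨a, b, hab⟩ := IsRightOre.exists_eq_mul_inv (P := P) γ.cocycle
  obtain ⟨c, d, hcd⟩ := IsRightOre.exists_eq_mul_inv (P := P) γ'.cocycle
  obtain ⟨m, n, hmn⟩ := IsRightOre.exists_eq_mul_inv (P := P) ((b : G)⁻¹ * c)
  refine ⟨a * m, d * n, ?_, ?_⟩
  · calc γ.cocycle * γ'.cocycle = a * ((b : G)⁻¹ * c) * (d : G)⁻¹ := by rw [hab, hcd]; group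
      _ = _ := by rw [hmn]; push_cast; group
  · have e : (b * m : P) = c * n := by
      apply Subtype.ext
      have : (c : G) = b * (m * (n : G)⁻¹) := by rw [← hmn]; group
      simp [this, mul_assoc]
    rw [← θ.toFun_toFun, γ.apply_source hab, θ.toFun_toFun, e, ← θ.toFun_toFun, ← h,
      γ'.apply_source hcd, θ.toFun_toFun]

/-- The product `(x, g)(y, h) = (x, g h)`, defined if `y = u(x, g)`. -/
def mul (γ γ' : θ.TransGroupoid) (h : γ'.range = γ.source) : θ.TransGroupoid :=
  ⟨(γ.range, γ.cocycle * γ'.cocycle),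
    let ⟨a, b, h₁, h₂⟩ := mul_aux γ γ' h; ⟨a, b, γ'.source, h₁, h₂⟩⟩

@[simp] theorem range_mul (γ γ' : θ.TransGroupoid) (h) : (γ.mul γ' h).range = γ.range := rfl
@[simp] theorem cocycle_mul (γ γ' : θ.TransGroupoid) (h) :
    (γ.mul γ' h).cocycle = γ.cocycle * γ'.cocycle := rfl
@[simp] theorem source_mul (γ γ' : θ.TransGroupoid) (h) : (γ.mul γ' h).source = γ'.source := by
  obtain ⟨a, b, h₁, h₂⟩ := mul_aux γ γ' h
  exact eq_source (γ.mul γ' h) h₁ h₂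

theorem inv_aux (γ : θ.TransGroupoid) :
    ∃ a b : P, γ.cocycle⁻¹ = a * (b : G)⁻¹ ∧ θ a γ.source = θ b γ.range := by
  obtain ⟨a, b, hab⟩ := IsRightOre.exists_eq_mul_inv (P := P) γ.cocycle
  exact ⟨b, a, by rw [hab]; group, (γ.apply_source hab).symm⟩

/-- The inverse `(x, g)⁻¹ = (u(x, g), g⁻¹)`. -/
def inv (γ : θ.TransGroupoid) : θ.TransGroupoid :=
  ⟨(γ.source, γ.cocycle⁻¹), let ⟨a, b, h₁, h₂⟩ := inv_aux γ; ⟨a, b, γ.range, h₁, h₂⟩⟩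

@[simp] theorem range_inv (γ : θ.TransGroupoid) : γ.inv.range = γ.source := rfl
@[simp] theorem cocycle_inv (γ : θ.TransGroupoid) : γ.inv.cocycle = γ.cocycle⁻¹ := rfl
@[simp] theorem source_inv (γ : θ.TransGroupoid) : γ.inv.source = γ.range := by
  obtain ⟨a, b, h₁, h₂⟩ := inv_aux γ
  exact eq_source γ.inv h₁ h₂

theorem inv_inv (γ : θ.TransGroupoid) : γ.inv.inv = γ := by
  ext <;> simp

end

variable [TopologicalSpace G]

/-- The relative topology of the product topology on `X × G`. -/
instance : TopologicalSpace θ.TransGroupoid := instTopologicalSpaceSubtype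

instance [T2Space X] [DiscreteTopology G] : T2Space θ.TransGroupoid :=
  inferInstanceAs (T2Space {p : X × G // p.2 ∈ θ.Q p.1})

theorem continuous_range : Continuous (range : θ.TransGroupoid → X) :=
  continuous_fst.comp continuous_subtype_val

theorem continuous_cocycle : Continuous (cocycle : θ.TransGroupoid → G) :=
  continuous_snd.comp continuous_subtype_val

variable [DiscreteTopology G] [CompactSpace X] [T2Space X] [IsRightOre P]

theorem continuous_source : Continuous (source : θ.TransGroupoid → X) := by
  rw [continuous_iff_continuousAt]
  intro γ
  obtain ⟨a, b, hab⟩ := IsRightOre.exists_eq_mul_inv (P := P) γ.cocycle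
  have hb := ((θ.continuous_toFun b).isClosedEmbedding (θ.injective_toFun b)).isInducing
  rw [hb.continuousAt_iff]
  have hev : ∀ᶠ γ' in nhds γ, cocycle γ' = γ.cocycle :=
    continuous_cocycle.continuousAt.eventually (p := fun g => g = γ.cocycle)
      ((isOpen_discrete {γ.cocycle}).mem_nhds rfl)
  refine ((θ.continuous_toFun a).comp continuous_range).continuousAt.congr ?_
  filter_upwards [hev] with γ' h
  exact γ'.apply_source (h.trans hab)

theorem continuous_inv : Continuous (inv : θ.TransGroupoid → θ.TransGroupoid) :=
  Continuous.subtype_mk (continuous_source.prodMk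
    ((continuous_of_discreteTopology (f := fun g : G => g⁻¹)).comp continuous_cocycle)) _

/-- The inverse map as a homeomorphism. -/
def invHomeomorph (θ : InjectiveAction P X) : θ.TransGroupoid ≃ₜ θ.TransGroupoid where
  toFun := inv
  invFun := inv
  left_inv := inv_inv
  right_inv := inv_inv
  continuous_toFun := continuous_inv
  continuous_invFun := continuous_inv

theorem isClopen_setOf_mem_Q (θ : InjectiveAction P X) (g : G) : IsClopen {x | g ∈ θ.Q x} := by
  obtain ⟨a, b, rfl⟩ := IsRightOre.exists_eq_mul_inv (P := P) g
  have : {x | (a : G) * (b : G)⁻¹ ∈ θ.Q x} = θ a ⁻¹' Set.range (θ b) := by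
    ext x
    constructor
    · rintro ⟨m, n, y, h, hy⟩
      exact ⟨y, (apply_eq_of_apply_eq h.symm hy).symm⟩
    · rintro ⟨y, hy⟩
      exact ⟨a, b, y, rfl, hy.symm⟩
  rw [this]
  exact ⟨((isCompact_range (θ.continuous_toFun b)).isClosed).preimage (θ.continuous_toFun a),
    (θ.isOpen_range b).preimage (θ.continuous_toFun a)⟩

theorem isClopen_carrier (θ : InjectiveAction P X) : IsClopen {p : X × G | p.2 ∈ θ.Q p.1} := by
  have key : ∀ S : G → Set X, (∀ g, IsOpen (S g)) → IsOpen {p : X × G | p.1 ∈ S p.2} := by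
    intro S hS
    have : {p : X × G | p.1 ∈ S p.2} = ⋃ g, S g ×ˢ {g} := by ext ⟨x, g⟩; simp
    rw [this]
    exact isOpen_iUnion fun g => (hS g).prod (isOpen_discrete _)
  refine ⟨⟨key (fun g => {x | g ∈ θ.Q x}ᶜ) fun g => ?_⟩, key (fun g => {x | g ∈ θ.Q x}) fun g => ?_⟩
  · exact (isClopen_setOf_mem_Q θ g).compl.isOpen
  · exact (isClopen_setOf_mem_Q θ g).isOpen

end TransGroupoid

open TransGroupoid

open Classical in
/-- Extension of a function on `X ⋊ P` to `X × G` by zero. -/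
def zeroExt (θ : InjectiveAction P X) (F : θ.TransGroupoid → ℂ) (p : X × G) : ℂ :=
  if h : p.2 ∈ θ.Q p.1 then F (ofMem p h) else 0

theorem zeroExt_of_mem (F : θ.TransGroupoid → ℂ) (p : X × G) (h : p.2 ∈ θ.Q p.1) :
    θ.zeroExt F p = F (ofMem p h) := dif_pos h

@[simp] theorem zeroExt_coe (F : θ.TransGroupoid → ℂ) (γ : θ.TransGroupoid) :
    θ.zeroExt F (γ.range, γ.cocycle) = F γ := dif_pos γ.2

theorem zeroExt_of_notMem (F : θ.TransGroupoid → ℂ) (p : X × G) (h : p.2 ∉ θ.Q p.1) :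
    θ.zeroExt F p = 0 := dif_neg h

theorem zeroExt_ne_zero {F : θ.TransGroupoid → ℂ} {p : X × G} (h : θ.zeroExt F p ≠ 0) :
    ∃ γ : θ.TransGroupoid, (γ.range, γ.cocycle) = p ∧ F γ ≠ 0 := by
  by_cases hp : p.2 ∈ θ.Q p.1
  · exact ⟨ofMem p hp, rfl, by rwa [zeroExt_of_mem F p hp] at h⟩
  · exact absurd (zeroExt_of_notMem F p hp) h

theorem finsum_fiber (F : θ.TransGroupoid → ℂ) (x : X) :
    ∑ᶠ γ : {γ : θ.TransGroupoid // γ.range = x}, F γ = ∑ᶠ g : G, θ.zeroExt F (x, g) := by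
  have hinj : Function.Injective fun γ : {γ : θ.TransGroupoid // γ.range = x} => γ.1.cocycle :=
    fun γ γ' h => Subtype.ext (TransGroupoid.ext (γ.2.trans γ'.2.symm) h)
  have h1 : ∑ᶠ γ : {γ : θ.TransGroupoid // γ.range = x}, F γ
      = ∑ᶠ γ : {γ : θ.TransGroupoid // γ.range = x}, θ.zeroExt F (x, γ.1.cocycle) :=
    finsum_congr fun γ => by
      have := zeroExt_coe F γ.1
      rw [γ.2] at this
      exact this.symm
  rw [h1, ← finsum_mem_range (f := fun g => θ.zeroExt F (x, g)) hinj,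
    ← finsum_mem_univ fun g => θ.zeroExt F (x, g)]
  refine finsum_mem_inter_support_eq _ _ _ (Set.ext fun g => ?_)
  refine ⟨fun h => ⟨trivial, h.2⟩, fun h => ⟨?_, h.2⟩⟩
  replace h : θ.zeroExt F (x, g) ≠ 0 := h.2
  obtain ⟨γ, hγ, -⟩ := zeroExt_ne_zero h
  exact ⟨⟨γ, congrArg Prod.fst hγ⟩, congrArg Prod.snd hγ⟩

variable [TopologicalSpace G] [DiscreteTopology G] [CompactSpace X] [T2Space X] [IsRightOre P]

theorem continuous_zeroExt {F : θ.TransGroupoid → ℂ} (hF : Continuous F) :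
    Continuous (θ.zeroExt F) := by
  rw [continuous_iff_continuousAt]
  intro p
  have hc := isClopen_carrier θ
  by_cases hp : p.2 ∈ θ.Q p.1
  · have he := hc.isOpen.isOpenEmbedding_subtypeVal
    refine (he.continuousAt_iff (x := ⟨p, hp⟩)).1 ?_
    have : θ.zeroExt F ∘ Subtype.val = F := by
      ext γ
      exact zeroExt_coe F γ
    change ContinuousAt (θ.zeroExt F ∘ Subtype.val) _
    exact this.symm ▸ hF.continuousAt
  · refine (continuousAt_const (y := (0 : ℂ))).congr ?_
    filter_upwards [hc.compl.isOpen.mem_nhds hp] with q hq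
    exact (zeroExt_of_notMem F q hq).symm

theorem continuous_zeroExt_slice {F : θ.TransGroupoid → ℂ} (hF : Continuous F) (g : G) :
    Continuous fun x => θ.zeroExt F (x, g) :=
  (continuous_zeroExt hF).comp (continuous_id.prodMk continuous_const)

/-- The finite set of all `g` such that the support of `ξ` meets `X × {g}`. -/
def cocycleSupport (ξ : C_c(θ.TransGroupoid, ℂ)) : Finset G :=
  ((ξ.hasCompactSupport.image continuous_cocycle).finite (DiscreteTopology.isDiscrete)).toFinset

theorem mem_cocycleSupport {ξ : C_c(θ.TransGroupoid, ℂ)} {γ : θ.TransGroupoid} (h : ξ γ ≠ 0) :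
    γ.cocycle ∈ cocycleSupport ξ := by
  rw [cocycleSupport, Set.Finite.mem_toFinset]
  exact ⟨γ, subset_tsupport _ h, rfl⟩

theorem zeroExt_eq_zero {ξ : C_c(θ.TransGroupoid, ℂ)} {x : X} {g : G}
    (h : g ∉ cocycleSupport ξ) : θ.zeroExt ξ (x, g) = 0 := by
  by_contra hne
  obtain ⟨γ, hγ, hγ'⟩ := zeroExt_ne_zero hne
  have h2 : γ.cocycle = g := congrArg Prod.snd hγ
  exact h (h2 ▸ mem_cocycleSupport hγ')

theorem hasCompactSupport_of_finite {F : θ.TransGroupoid → ℂ} (s : Finset G)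
    (h : ∀ γ : θ.TransGroupoid, F γ ≠ 0 → γ.cocycle ∈ s) : HasCompactSupport F := by
  have hK : IsCompact ((Set.univ : Set X) ×ˢ (s : Set G)) :=
    isCompact_univ.prod s.finite_toSet.isCompact
  have hK' : IsCompact (Subtype.val ⁻¹' ((Set.univ : Set X) ×ˢ (s : Set G)) :
      Set θ.TransGroupoid) :=
    (isClopen_carrier θ).isClosed.isClosedEmbedding_subtypeVal.isCompact_preimage hK
  refine HasCompactSupport.intro hK' fun γ hγ => ?_
  by_contra hne
  exact hγ ⟨trivial, h γ hne⟩

/-- `C_c(X ⋊ P)`, regarded as an inner product module over `C(X)`. -/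
def CcL2 (θ : InjectiveAction P X) : Type _ := C_c(θ.TransGroupoid, ℂ)

namespace CcL2

instance : AddCommGroup θ.CcL2 := inferInstanceAs (AddCommGroup C_c(θ.TransGroupoid, ℂ))
instance : Module ℂ θ.CcL2 := inferInstanceAs (Module ℂ C_c(θ.TransGroupoid, ℂ))
instance : FunLike θ.CcL2 θ.TransGroupoid ℂ :=
  inferInstanceAs (FunLike C_c(θ.TransGroupoid, ℂ) θ.TransGroupoid ℂ)

/-- A function in `C_c(X ⋊ P)` as an element of the inner product module. -/
def of (θ : InjectiveAction P X) : C_c(θ.TransGroupoid, ℂ) ≃ₗ[ℂ] θ.CcL2 := LinearEquiv.refl _ _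

@[ext] theorem ext {ξ η : θ.CcL2} (h : ∀ γ, ξ γ = η γ) : ξ = η :=
  CompactlySupportedContinuousMap.ext h

theorem add_apply (ξ η : θ.CcL2) (γ) : (ξ + η) γ = ξ γ + η γ := rfl
theorem smul_apply (z : ℂ) (ξ : θ.CcL2) (γ) : (z • ξ) γ = z * ξ γ := rfl
theorem zero_apply (γ) : (0 : θ.CcL2) γ = 0 := rfl
protected theorem continuous (ξ : θ.CcL2) : Continuous ξ :=
  (show C_c(θ.TransGroupoid, ℂ) from ξ).continuous

theorem zeroExt_add (ξ η : θ.CcL2) (p) :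
    θ.zeroExt (ξ + η : θ.CcL2) p = θ.zeroExt ξ p + θ.zeroExt η p := by
  unfold zeroExt; split_ifs <;> simp [add_apply]

theorem zeroExt_smul (z : ℂ) (ξ : θ.CcL2) (p) :
    θ.zeroExt (z • ξ : θ.CcL2) p = z * θ.zeroExt ξ p := by
  unfold zeroExt; split_ifs <;> simp [smul_apply]

/-- The action `(ξ f)(x, g) = ξ(x, g) f(x)` of `C(X)`. -/
instance : SMul C(X, ℂ) θ.CcL2 where
  smul f ξ := of θ
    { toFun := fun γ => ξ γ * f γ.range
      continuous_toFun := ξ.continuous.mul (f.continuous.comp continuous_range)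
      hasCompactSupport' := hasCompactSupport_of_finite (cocycleSupport ξ) fun _ h =>
        mem_cocycleSupport (left_ne_zero_of_mul h) }

theorem smul_apply' (f : C(X, ℂ)) (ξ : θ.CcL2) (γ) : (f • ξ) γ = ξ γ * f γ.range := rfl

instance : Module C(X, ℂ) θ.CcL2 where
  one_smul ξ := by ext γ; simp [smul_apply']
  mul_smul f f' ξ := by ext γ; simp only [smul_apply', ContinuousMap.mul_apply]; ring
  smul_zero f := by ext γ; simp [smul_apply', zero_apply]
  smul_add f ξ η := by ext γ; simp only [smul_apply', add_apply]; ring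
  add_smul f f' ξ := by ext γ; simp only [smul_apply', add_apply, ContinuousMap.add_apply]; ring
  zero_smul ξ := by ext γ; simp [smul_apply', zero_apply]

theorem zeroExt_smul' (f : C(X, ℂ)) (ξ : θ.CcL2) (p) :
    θ.zeroExt (f • ξ : θ.CcL2) p = θ.zeroExt ξ p * f p.1 := by
  unfold zeroExt; split_ifs <;> simp [smul_apply']

theorem inner_aux (ξ η : θ.CcL2) (x : X) (s : Finset G) (hs : cocycleSupport ξ ⊆ s) :
    ∑ᶠ γ : {γ : θ.TransGroupoid // γ.range = x}, star (ξ γ) * η γ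
      = ∑ g ∈ s, star (θ.zeroExt ξ (x, g)) * θ.zeroExt η (x, g) := by
  rw [finsum_fiber (fun γ => star (ξ γ) * η γ) x]
  have : ∀ g, θ.zeroExt (fun γ => star (ξ γ) * η γ) (x, g)
      = star (θ.zeroExt ξ (x, g)) * θ.zeroExt η (x, g) := fun g => by
    unfold zeroExt; split_ifs <;> simp
  simp only [this]
  refine finsum_eq_sum_of_support_subset _ fun g hg => ?_
  by_contra hne
  have h0 : θ.zeroExt ξ (x, g) = 0 := zeroExt_eq_zero fun h => hne (hs h)
  exact hg (by simp [h0])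

/-- The inner product `⟨ξ, η⟩(x) = ∑_g conj (ξ(x, g)) η(x, g)`, the sum being over all elements
`(x, g)` of `X ⋊ P` with range `x`. -/
instance : Inner C(X, ℂ) θ.CcL2 where
  inner ξ η :=
    { toFun := fun x => ∑ᶠ γ : {γ : θ.TransGroupoid // γ.range = x}, star (ξ γ) * η γ
      continuous_toFun := by
        simp only [fun x => inner_aux ξ η x _ subset_rfl]
        exact continuous_finsetSum _ fun g _ =>
          (continuous_zeroExt_slice ξ.continuous g).star.mul
            (continuous_zeroExt_slice η.continuous g) }

theorem inner_apply (ξ η : θ.CcL2) (x : X) (s : Finset G) (hs : cocycleSupport ξ ⊆ s) :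
    inner C(X, ℂ) ξ η x = ∑ g ∈ s, star (θ.zeroExt ξ (x, g)) * θ.zeroExt η (x, g) :=
  inner_aux ξ η x s hs

/-- The norm `‖ξ‖ = ‖⟨ξ, ξ⟩‖^(1/2)`. -/
instance : Norm θ.CcL2 := CStarModule.norm C(X, ℂ)

instance : CStarModule C(X, ℂ) θ.CcL2 where
  inner_add_right {ξ η ζ} := by
    ext x
    simp only [ContinuousMap.add_apply, inner_apply ξ _ x _ subset_rfl, zeroExt_add, mul_add,
      Finset.sum_add_distrib]
  inner_self_nonneg {ξ} := by
    rw [ContinuousMap.le_def]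
    intro x
    rw [inner_apply ξ _ x _ subset_rfl]
    exact Finset.sum_nonneg fun g _ => star_mul_self_nonneg _
  inner_self {ξ} := by
    refine ⟨fun h => ?_, fun h => ?_⟩
    · ext γ
      have h1 := inner_apply ξ ξ γ.range _ subset_rfl
      rw [h, ContinuousMap.zero_apply, eq_comm,
        Finset.sum_eq_zero_iff_of_nonneg fun g _ => star_mul_self_nonneg _] at h1
      by_contra hne
      have := h1 γ.cocycle (mem_cocycleSupport hne)
      rw [zeroExt_coe] at this
      simp at this
      exact hne this
    · ext x
      rw [inner_apply ξ _ x _ subset_rfl]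
      refine Finset.sum_eq_zero fun g _ => ?_
      have : θ.zeroExt ξ (x, g) = 0 := by
        subst h; unfold zeroExt; split_ifs <;> simp [zero_apply]
      simp [this]
  inner_op_smul_right {f ξ η} := by
    ext x
    simp only [ContinuousMap.mul_apply, inner_apply ξ _ x _ subset_rfl, zeroExt_smul',
      Finset.mul_sum]
    exact Finset.sum_congr rfl fun g _ => by ring
  inner_smul_right_complex {z ξ η} := by
    ext x
    simp only [ContinuousMap.smul_apply, inner_apply ξ _ x _ subset_rfl, zeroExt_smul,
      smul_eq_mul, Finset.mul_sum]
    exact Finset.sum_congr rfl fun g _ => by ring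
  star_inner ξ η := by
    classical
    ext x
    rw [ContinuousMap.star_apply,
      inner_apply ξ η x (cocycleSupport ξ ∪ cocycleSupport η) Finset.subset_union_left,
      inner_apply η ξ x (cocycleSupport ξ ∪ cocycleSupport η) Finset.subset_union_right, star_sum]
    exact Finset.sum_congr rfl fun g _ => by simp [mul_comm]
  norm_eq_sqrt_norm_inner_self _ := rfl

instance : NormedAddCommGroup θ.CcL2 := CStarModule.normedAddCommGroup C(X, ℂ)

instance : NormedSpace ℂ θ.CcL2 := .ofCore (CStarModule.normedSpaceCore C(X, ℂ))

instance : UniformContinuousConstSMul C(X, ℂ) θ.CcL2 := CStarModule.uniformContinuousConstSMul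

end CcL2

/-- The Hilbert `C(X)`-module `l²(X ⋊ P)`: the completion of `C_c(X ⋊ P)`. -/
abbrev L2 (θ : InjectiveAction P X) : Type _ := UniformSpace.Completion θ.CcL2

/-- `(π̃(f) ξ)(γ) = ∑ f(γ⁻¹ γ') ξ(γ')`, the sum being over all `γ'` with the same range as `γ`. For
`γ = (x, g)` and `γ' = (x, h)` one has `γ⁻¹ γ' = (u(x, g), g⁻¹ h)`. -/
def convFun (f ξ : C_c(θ.TransGroupoid, ℂ)) (γ : θ.TransGroupoid) : ℂ :=
  ∑ᶠ γ' : {γ' : θ.TransGroupoid // γ'.range = γ.range},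
    f (γ.inv.mul γ' (γ'.2.trans γ.source_inv.symm)) * ξ γ'

theorem zeroExt_mul_aux (f ξ : C_c(θ.TransGroupoid, ℂ)) (γ : θ.TransGroupoid) (h : G) :
    θ.zeroExt (fun γ' => θ.zeroExt f (γ.source, γ.cocycle⁻¹ * γ'.cocycle) * ξ γ') (γ.range, h)
      = θ.zeroExt f (γ.source, γ.cocycle⁻¹ * h) * θ.zeroExt ξ (γ.range, h) := by
  by_cases hp : h ∈ θ.Q γ.range
  · rw [zeroExt_of_mem _ (γ.range, h) hp, zeroExt_of_mem _ (γ.range, h) hp]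
    rfl
  · rw [zeroExt_of_notMem _ (γ.range, h) hp, zeroExt_of_notMem _ (γ.range, h) hp, mul_zero]

theorem convFun_eq_finsum (f ξ : C_c(θ.TransGroupoid, ℂ)) (γ : θ.TransGroupoid) :
    convFun f ξ γ = ∑ᶠ h : G,
      θ.zeroExt f (γ.source, γ.cocycle⁻¹ * h) * θ.zeroExt ξ (γ.range, h) := by
  simp only [← zeroExt_mul_aux]
  rw [← finsum_fiber]
  refine finsum_congr fun γ' => ?_
  congr 1
  exact (zeroExt_coe f (γ.inv.mul γ' (γ'.2.trans γ.source_inv.symm))).symm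

theorem convFun_eq_sum (f ξ : C_c(θ.TransGroupoid, ℂ)) (γ : θ.TransGroupoid) (s : Finset G)
    (hs : cocycleSupport ξ ⊆ s) :
    convFun f ξ γ = ∑ h ∈ s,
      θ.zeroExt f (γ.source, γ.cocycle⁻¹ * h) * θ.zeroExt ξ (γ.range, h) := by
  rw [convFun_eq_finsum]
  refine finsum_eq_sum_of_support_subset _ fun h hh => ?_
  by_contra hne
  have h0 : θ.zeroExt ξ (γ.range, h) = 0 := zeroExt_eq_zero fun h => hne (hs h)
  exact hh (by simp [h0])

theorem convFun_eq_sum' (f ξ : C_c(θ.TransGroupoid, ℂ)) (γ : θ.TransGroupoid) :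
    convFun f ξ γ = ∑ k ∈ cocycleSupport f,
      θ.zeroExt f (γ.source, k) * θ.zeroExt ξ (γ.range, γ.cocycle * k) := by
  rw [convFun_eq_finsum, ← finsum_comp_equiv (Equiv.mulLeft γ.cocycle)]
  simp only [Equiv.coe_mulLeft, inv_mul_cancel_left]
  refine finsum_eq_sum_of_support_subset _ fun h hh => ?_
  by_contra hne
  have h0 : θ.zeroExt f (γ.source, h) = 0 := zeroExt_eq_zero hne
  exact hh (by simp [h0])

/-- `π̃(f) ξ` as an element of `C_c(X ⋊ P)`. -/
def conv (f ξ : C_c(θ.TransGroupoid, ℂ)) : C_c(θ.TransGroupoid, ℂ) where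
  toFun := convFun f ξ
  continuous_toFun := by
    refine (continuous_congr fun γ => convFun_eq_sum f ξ γ _ subset_rfl).2 ?_
    refine continuous_finsetSum _ fun h _ => Continuous.mul ?_ ?_
    · exact (continuous_zeroExt f.continuous).comp (continuous_source.prodMk
        ((continuous_of_discreteTopology (f := fun g : G => g⁻¹ * h)).comp continuous_cocycle))
    · exact (continuous_zeroExt ξ.continuous).comp (continuous_range.prodMk continuous_const)
  hasCompactSupport' := by
    classical
    refine hasCompactSupport_of_finite
      ((cocycleSupport ξ ×ˢ cocycleSupport f).image fun p => p.1 * p.2⁻¹) fun γ hγ => ?_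
    rw [convFun_eq_sum'] at hγ
    obtain ⟨k, hk, hne⟩ := Finset.exists_ne_zero_of_sum_ne_zero hγ
    refine Finset.mem_image.2 ⟨(γ.cocycle * k, k), Finset.mem_product.2 ⟨?_, hk⟩, by simp⟩
    by_contra h
    exact hne (by rw [zeroExt_eq_zero h, mul_zero])

/-- `π̃(f)` as a linear map on `C_c(X ⋊ P)`. -/
def convLinear (f : C_c(θ.TransGroupoid, ℂ)) : θ.CcL2 →ₗ[ℂ] θ.CcL2 where
  toFun ξ := CcL2.of θ (conv f ((CcL2.of θ).symm ξ))
  map_add' ξ η := by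
    ext γ
    change convFun f _ γ = convFun f _ γ + convFun f _ γ
    rw [convFun_eq_sum', convFun_eq_sum', convFun_eq_sum', ← Finset.sum_add_distrib]
    refine Finset.sum_congr rfl fun k _ => ?_
    rw [← mul_add]
    congr 1
    exact CcL2.zeroExt_add ξ η _
  map_smul' z ξ := by
    ext γ
    change convFun f _ γ = z * convFun f _ γ
    rw [convFun_eq_sum', convFun_eq_sum', Finset.mul_sum]
    refine Finset.sum_congr rfl fun k _ => ?_
    rw [mul_left_comm]
    congr 1
    exact CcL2.zeroExt_smul z ξ _

theorem convLinear_apply (f : C_c(θ.TransGroupoid, ℂ)) (ξ : θ.CcL2) (γ) :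
    convLinear f ξ γ = convFun f ((CcL2.of θ).symm ξ) γ := rfl

namespace CcL2

theorem sum_norm_sq_le (ξ : θ.CcL2) (x : X) (s : Finset G) :
    ∑ g ∈ s, ‖θ.zeroExt ξ (x, g)‖ ^ 2 ≤ ‖ξ‖ ^ 2 := by
  classical
  have h1 : ∑ g ∈ s, ‖θ.zeroExt ξ (x, g)‖ ^ 2
      ≤ ∑ g ∈ s ∪ cocycleSupport ξ, ‖θ.zeroExt ξ (x, g)‖ ^ 2 :=
    Finset.sum_le_sum_of_subset_of_nonneg Finset.subset_union_left fun _ _ _ => by positivity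
  have h2 : inner C(X, ℂ) ξ ξ x
      = ((∑ g ∈ s ∪ cocycleSupport ξ, ‖θ.zeroExt ξ (x, g)‖ ^ 2 : ℝ) : ℂ) := by
    rw [inner_apply ξ ξ x _ Finset.subset_union_right, Complex.ofReal_sum]
    refine Finset.sum_congr rfl fun g _ => ?_
    rw [Complex.ofReal_pow]
    exact Complex.conj_mul' _
  refine h1.trans ?_
  rw [CStarModule.norm_sq_eq C(X, ℂ)]
  refine le_trans (le_of_eq ?_) (ContinuousMap.norm_coe_le_norm (inner C(X, ℂ) ξ ξ) x)
  rw [h2, Complex.norm_real, Real.norm_of_nonneg (Finset.sum_nonneg fun _ _ => by positivity)]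

theorem norm_sq_le (ξ : θ.CcL2) {M : ℝ} (hM : 0 ≤ M)
    (h : ∀ x, ∑ g ∈ cocycleSupport ξ, ‖θ.zeroExt ξ (x, g)‖ ^ 2 ≤ M) : ‖ξ‖ ^ 2 ≤ M := by
  rw [CStarModule.norm_sq_eq C(X, ℂ), ContinuousMap.norm_le _ hM]
  intro x
  have h2 : inner C(X, ℂ) ξ ξ x
      = ((∑ g ∈ cocycleSupport ξ, ‖θ.zeroExt ξ (x, g)‖ ^ 2 : ℝ) : ℂ) := by
    rw [inner_apply ξ ξ x _ subset_rfl, Complex.ofReal_sum]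
    refine Finset.sum_congr rfl fun g _ => ?_
    rw [Complex.ofReal_pow]
    exact Complex.conj_mul' _
  rw [h2, Complex.norm_real, Real.norm_of_nonneg (Finset.sum_nonneg fun _ _ => by positivity)]
  exact h x

end CcL2

theorem exists_bound (f : C_c(θ.TransGroupoid, ℂ)) :
    ∃ C : ℝ, 0 ≤ C ∧ ∀ p, ‖θ.zeroExt f p‖ ≤ C := by
  obtain ⟨C, hC⟩ := f.hasCompactSupport.exists_bound_of_continuous f.continuous
  refine ⟨max C 0, le_max_right _ _, fun p => ?_⟩
  unfold zeroExt
  split_ifs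
  · exact (hC _).trans (le_max_left _ _)
  · simp

theorem exists_convLinear_bound (f : C_c(θ.TransGroupoid, ℂ)) :
    ∃ C : ℝ, ∀ ξ, ‖convLinear f ξ‖ ≤ C * ‖ξ‖ := by
  obtain ⟨C, hC, hf⟩ := exists_bound f
  refine ⟨(cocycleSupport f).card * C, fun ξ => ?_⟩
  suffices h : ‖convLinear f ξ‖ ^ 2 ≤ ((cocycleSupport f).card * C * ‖ξ‖) ^ 2 from
    (pow_le_pow_iff_left₀ (norm_nonneg _) (by positivity) (by simp)).mp h
  refine CcL2.norm_sq_le _ (by positivity) fun x => ?_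
  have hpt : ∀ g, ‖θ.zeroExt (convLinear f ξ) (x, g)‖ ^ 2
      ≤ (cocycleSupport f).card * ∑ k ∈ cocycleSupport f, C ^ 2 * ‖θ.zeroExt ξ (x, g * k)‖ ^ 2 := by
    intro g
    by_cases hg : g ∈ θ.Q x
    · rw [zeroExt_of_mem _ _ hg, convLinear_apply, convFun_eq_sum']
      calc _ ≤ (∑ k ∈ cocycleSupport f, C * ‖θ.zeroExt ξ (x, g * k)‖) ^ 2 := by
            gcongr
            refine (norm_sum_le _ _).trans (Finset.sum_le_sum fun k _ => ?_)
            rw [norm_mul]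
            exact mul_le_mul (hf _) le_rfl (norm_nonneg _) hC
        _ ≤ _ := by
            refine sq_sum_le_card_mul_sum_sq.trans (le_of_eq ?_)
            simp only [mul_pow]
    · rw [zeroExt_of_notMem _ _ hg]
      simp only [norm_zero, ne_eq, OfNat.ofNat_ne_zero, not_false_eq_true, zero_pow]
      positivity
  refine (Finset.sum_le_sum fun g _ => hpt g).trans ?_
  rw [← Finset.mul_sum, Finset.sum_comm]
  have hk : ∀ k ∈ cocycleSupport f,
      ∑ g ∈ cocycleSupport ((CcL2.of θ).symm (convLinear f ξ)),
        C ^ 2 * ‖θ.zeroExt ξ (x, g * k)‖ ^ 2 ≤ C ^ 2 * ‖ξ‖ ^ 2 := by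
    intro k _
    rw [← Finset.mul_sum]
    gcongr
    have := CcL2.sum_norm_sq_le ξ x
      ((cocycleSupport ((CcL2.of θ).symm (convLinear f ξ))).map (mulRightEmbedding k))
    rwa [Finset.sum_map] at this
  calc _ ≤ (cocycleSupport f).card * ∑ k ∈ cocycleSupport f, C ^ 2 * ‖ξ‖ ^ 2 := by
        gcongr with k hk'
        exact hk k hk'
    _ = _ := by rw [Finset.sum_const, nsmul_eq_mul]; ring

/-- `π̃(f)` as a bounded operator on `C_c(X ⋊ P)`. -/
def convCLM (f : C_c(θ.TransGroupoid, ℂ)) : θ.CcL2 →L[ℂ] θ.CcL2 :=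
  (convLinear f).mkContinuousOfExistsBound (exists_convLinear_bound f)

/-- The involution `f*(γ) = conj (f(γ⁻¹))` of `C_c(X ⋊ P)`. -/
def involution (f : C_c(θ.TransGroupoid, ℂ)) : C_c(θ.TransGroupoid, ℂ) where
  toFun γ := star (f γ.inv)
  continuous_toFun := (f.continuous.comp continuous_inv).star
  hasCompactSupport' :=
    (f.hasCompactSupport.comp_homeomorph (invHomeomorph θ)).comp_left (star_zero ℂ)

theorem zeroExt_involution (f : C_c(θ.TransGroupoid, ℂ)) (γ γ' : θ.TransGroupoid)
    (h : γ.range = γ'.range) :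
    θ.zeroExt (involution f) (γ'.source, γ'.cocycle⁻¹ * γ.cocycle)
      = star (θ.zeroExt f (γ.source, γ.cocycle⁻¹ * γ'.cocycle)) := by
  have h1 := zeroExt_coe f (γ.inv.mul γ' (h.symm.trans γ.source_inv.symm))
  have h2 := zeroExt_coe (involution f) (γ'.inv.mul γ (h.trans γ'.source_inv.symm))
  simp only [range_mul, range_inv, cocycle_mul, cocycle_inv] at h1 h2
  rw [h1, h2]
  change star (f _) = star (f _)
  congr 2
  ext <;> simp

theorem inner_convCLM (f : C_c(θ.TransGroupoid, ℂ)) (ξ η : θ.CcL2) :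
    inner C(X, ℂ) (convCLM f ξ) η = inner C(X, ℂ) ξ (convCLM (involution f) η) := by
  have key : ∀ (f : C_c(θ.TransGroupoid, ℂ)) (ξ η : θ.CcL2) (x : X),
      inner C(X, ℂ) ξ (convCLM f η) x
        = ∑ g ∈ cocycleSupport ((CcL2.of θ).symm ξ), ∑ h ∈ cocycleSupport ((CcL2.of θ).symm η),
          star (θ.zeroExt ξ (x, g)) * (θ.zeroExt (fun γ => θ.zeroExt f
            (γ.source, γ.cocycle⁻¹ * h)) (x, g) * θ.zeroExt η (x, h)) := by
    intro f ξ η x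
    rw [CcL2.inner_apply ξ _ x _ subset_rfl]
    refine Finset.sum_congr rfl fun g _ => ?_
    rw [← Finset.mul_sum]
    congr 1
    by_cases hg : g ∈ θ.Q x
    · simp only [zeroExt_of_mem _ (x, g) hg]
      exact convFun_eq_sum f ((CcL2.of θ).symm η) (ofMem (x, g) hg) _ subset_rfl
    · simp [zeroExt_of_notMem _ (x, g) hg]
  ext x
  rw [show inner C(X, ℂ) (convCLM f ξ) η = star (inner C(X, ℂ) η (convCLM f ξ)) from
    (CStarModule.star_inner (A := C(X, ℂ)) η (convCLM f ξ)).symm, ContinuousMap.star_apply, key, key, Finset.sum_comm, star_sum]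
  refine Finset.sum_congr rfl fun h _ => ?_
  rw [star_sum]
  refine Finset.sum_congr rfl fun g _ => ?_
  by_cases hh : h ∈ θ.Q x
  · by_cases hg : g ∈ θ.Q x
    · have := zeroExt_involution f (ofMem (x, g) hg) (ofMem (x, h) hh) rfl
      simp only [zeroExt_of_mem _ (x, g) hg, zeroExt_of_mem _ (x, h) hh] at this ⊢
      change _ = star (ξ _) * (θ.zeroExt (involution f) (_, (ofMem (x, h) hh).cocycle⁻¹ *
        (ofMem (x, g) hg).cocycle) * η _)
      rw [this, star_mul, star_mul, star_star]
      rw [mul_assoc]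
      rfl
    · simp [zeroExt_of_notMem _ (x, g) hg]
  · simp [zeroExt_of_notMem _ (x, h) hh]

/-- The representation `π̃` of `C_c(X ⋊ P)` on `l²(X ⋊ P)`. -/
def regularRep (f : C_c(θ.TransGroupoid, ℂ)) : Adjointable C(X, ℂ) θ.L2 :=
  Adjointable.mk (convCLM f).completion (convCLM (involution f)).completion fun x y => by
    have hc := CStarModule.continuous_completion_inner (A := C(X, ℂ)) (E := θ.CcL2)
    refine UniformSpace.Completion.induction_on₂ x y (isClosed_eq
      (hc.comp (((ContinuousLinearMap.continuous _).comp continuous_fst).prodMk continuous_snd))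
      (hc.comp (continuous_fst.prodMk ((ContinuousLinearMap.continuous _).comp continuous_snd))))
      fun ξ η => ?_
    simp only [ContinuousLinearMap.completion_apply_coe, CStarModule.completion_inner_coe]
    exact inner_convCLM f ξ η

/-- The reduced groupoid C⋆-algebra `C*_r(X ⋊ P)`: the C⋆-algebra generated by `π̃(C_c(X ⋊ P))` in
`𝓛(l²(X ⋊ P))`. -/
def reducedGroupoidCStar (θ : InjectiveAction P X) :
    NonUnitalStarSubalgebra ℂ (Adjointable C(X, ℂ) θ.L2) :=
  Adjointable.cstarGenerated (Set.range (regularRep (θ := θ)))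

/-- The multiplication by the characteristic function of `X_g = {x : (x, g) ∈ X ⋊ P}`. -/
def restrict (θ : InjectiveAction P X) (g : G) (f : C(X, ℂ)) : C(X, ℂ) where
  toFun x := θ.zeroExt (fun γ => f γ.range) (x, g)
  continuous_toFun := continuous_zeroExt_slice (f.continuous.comp continuous_range) g

theorem restrict_of_mem {g : G} {x : X} (h : g ∈ θ.Q x) (f : C(X, ℂ)) :
    θ.restrict g f x = f x := zeroExt_of_mem (fun γ : θ.TransGroupoid => f γ.range) (x, g) h

theorem restrict_of_notMem {g : G} {x : X} (h : g ∉ θ.Q x) (f : C(X, ℂ)) :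
    θ.restrict g f x = 0 :=
  zeroExt_of_notMem (fun γ : θ.TransGroupoid => f γ.range) (x, g) h

/-- `f ∘ u(·, g)` on `X_g`, and zero on its complement. -/
def translate (θ : InjectiveAction P X) (g : G) (f : C(X, ℂ)) : C(X, ℂ) where
  toFun x := θ.zeroExt (fun γ => f γ.source) (x, g)
  continuous_toFun := continuous_zeroExt_slice (f.continuous.comp continuous_source) g

theorem translate_of_mem {g : G} {x : X} (h : g ∈ θ.Q x) (f : C(X, ℂ)) :
    θ.translate g f x = f (ofMem (x, g) h).source :=
  zeroExt_of_mem (fun γ : θ.TransGroupoid => f γ.source) (x, g) h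

theorem translate_of_notMem {g : G} {x : X} (h : g ∉ θ.Q x) (f : C(X, ℂ)) :
    θ.translate g f x = 0 :=
  zeroExt_of_notMem (fun γ : θ.TransGroupoid => f γ.source) (x, g) h

/-- The ideal `C(X_g)` of `C(X)`, for the clopen set `X_g = {x : (x, g) ∈ X ⋊ P}`: the functions
vanishing outside `X_g`. -/
def domainIdeal (θ : InjectiveAction P X) (g : G) : NonUnitalStarSubalgebra ℂ C(X, ℂ) where
  carrier := {f | ∀ x, g ∉ θ.Q x → f x = 0}
  add_mem' hf hf' x hx := by simp [hf x hx, hf' x hx]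
  zero_mem' _ _ := rfl
  mul_mem' hf _ x hx := by simp [hf x hx]
  smul_mem' c f hf x hx := by simp [hf x hx]
  star_mem' hf x hx := by simp [hf x hx]

theorem mem_domainIdeal {g : G} {f : C(X, ℂ)} :
    f ∈ θ.domainIdeal g ↔ ∀ x, g ∉ θ.Q x → f x = 0 := Iff.rfl

theorem restrict_mem (g : G) (f : C(X, ℂ)) : θ.restrict g f ∈ θ.domainIdeal g :=
  fun _ hx => restrict_of_notMem hx f

theorem translate_mem (g : G) (f : C(X, ℂ)) : θ.translate g f ∈ θ.domainIdeal g :=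
  fun _ hx => translate_of_notMem hx f

theorem translate_translate_inv {g h : G} (hgh : h = g⁻¹) {f : C(X, ℂ)} (hf : f ∈ θ.domainIdeal g) :
    θ.translate g (θ.translate h f) = f := by
  subst hgh
  ext x
  by_cases hx : g ∈ θ.Q x
  · rw [translate_of_mem hx]
    refine (translate_of_mem (ofMem (x, g) hx).inv.2 f).trans ?_
    exact congrArg f (ofMem (x, g) hx).source_inv
  · rw [translate_of_notMem hx, hf x hx]

/-- The partial action of `G` on `C(X)`: the `*`-isomorphism `α̂_g : C(X_{g⁻¹}) → C(X_g)` with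
`α̂_g(f)(x) = f(u(x, g))` for `x ∈ X_g`. -/
def alphaHat (θ : InjectiveAction P X) (g : G) : θ.domainIdeal g⁻¹ ≃⋆ₐ[ℂ] θ.domainIdeal g where
  toFun f := ⟨θ.translate g f.1, translate_mem g f.1⟩
  invFun f := ⟨θ.translate g⁻¹ f.1, translate_mem (θ := θ) g⁻¹ f.1⟩
  left_inv f := Subtype.ext (translate_translate_inv (inv_inv g).symm f.2)
  right_inv f := Subtype.ext (translate_translate_inv rfl f.2)
  map_mul' f f' := by
    ext x
    by_cases hx : g ∈ θ.Q x <;> simp [translate_of_mem, translate_of_notMem, hx]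
  map_add' f f' := by
    ext x
    by_cases hx : g ∈ θ.Q x <;> simp [translate_of_mem, translate_of_notMem, hx]
  map_star' f := by
    ext x
    by_cases hx : g ∈ θ.Q x <;> simp [translate_of_mem, translate_of_notMem, hx]
  map_smul' c f := by
    ext x
    by_cases hx : g ∈ θ.Q x <;> simp [translate_of_mem, translate_of_notMem, hx]

theorem summable_of_nonneg_of_le {ι : Type*} {a b : ι → C(X, ℂ)} (h0 : ∀ i, 0 ≤ a i)
    (hab : ∀ i, a i ≤ b i) (hb : Summable b) : Summable a := by
  rw [summable_iff_vanishing_norm] at hb ⊢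
  intro ε hε
  obtain ⟨s, hs⟩ := hb ε hε
  refine ⟨s, fun t ht => lt_of_le_of_lt ?_ (hs t ht)⟩
  exact CStarAlgebra.norm_le_norm_of_nonneg_of_le (Finset.sum_nonneg fun i _ => h0 i)
    (Finset.sum_le_sum fun i _ => hab i)

theorem summable_add {ι : Type*} {ξ η : ι → C(X, ℂ)} (hξ : Summable fun i => star (ξ i) * ξ i)
    (hη : Summable fun i => star (η i) * η i) :
    Summable fun i => star (ξ i + η i) * (ξ i + η i) := by
  refine summable_of_nonneg_of_le (fun i => star_mul_self_nonneg _) (fun i => ?_)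
    ((hξ.add hη).add (hξ.add hη))
  rw [← sub_nonneg]
  convert star_mul_self_nonneg (ξ i - η i) using 1
  simp only [star_add, star_sub]
  ring

theorem summable_smul {ι : Type*} {ξ : ι → C(X, ℂ)} (hξ : Summable fun i => star (ξ i) * ξ i)
    (f : C(X, ℂ)) : Summable fun i => star (f * ξ i) * (f * ξ i) := by
  refine (hξ.mul_left (star f * f)).congr fun i => ?_
  rw [star_mul]
  ring

theorem summable_inner {ι : Type*} {ξ η : ι → C(X, ℂ)} (hξ : Summable fun i => star (ξ i) * ξ i)
    (hη : Summable fun i => star (η i) * η i) : Summable fun i => star (ξ i) * η i := by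
  let c : C(X, ℂ) := ContinuousMap.const X Complex.I
  let d : C(X, ℂ) := ContinuousMap.const X (1 / 2)
  have h1 := summable_add hξ hη
  have h2 := summable_add hξ (summable_smul hη c)
  have h3 := summable_add hξ hη
  refine (((h1.sub (hξ.add hη)).sub ((h2.sub (hξ.add hη)).mul_left c)).mul_left d).congr
    fun i => ?_
  ext x
  simp only [c, d, ContinuousMap.mul_apply, ContinuousMap.sub_apply, ContinuousMap.add_apply,
    ContinuousMap.star_apply, ContinuousMap.const_apply, star_add, star_mul, RCLike.star_def,
    Complex.conj_I]
  linear_combination (norm := ring_nf)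
    (-(1 / 2 : ℂ) * (starRingEnd ℂ (ξ i x) * η i x - starRingEnd ℂ (η i x) * ξ i x)
      + (1 / 2 : ℂ) * Complex.I * (starRingEnd ℂ (η i x) * η i x)) * Complex.I_sq

/-- `F`, as a `C(X)`-submodule of the module of all maps from `G` to `C(X)`: the maps `ξ` with
`ξ(g) ∈ C(X_g)` for all `g` such that `∑_g |ξ(g)|²` converges in `C(X)`. -/
def partialSubmodule (θ : InjectiveAction P X) : Submodule C(X, ℂ) (G → C(X, ℂ)) where
  carrier := {ξ | (∀ g, ξ g ∈ θ.domainIdeal g) ∧ Summable fun g => star (ξ g) * ξ g}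
  add_mem' h h' := ⟨fun g => add_mem (h.1 g) (h'.1 g), summable_add h.2 h'.2⟩
  zero_mem' := ⟨fun g => zero_mem _, by simp⟩
  smul_mem' f ξ h := ⟨fun g x hx => by simp [h.1 g x hx], summable_smul h.2 f⟩

/-- The Hilbert `C(X)`-module `F = {ξ ∈ l²(G, C(X)) : ξ(g) ∈ C(X_g) for all g}`. -/
def PartialL2 (θ : InjectiveAction P X) : Type _ := θ.partialSubmodule

namespace PartialL2

instance : AddCommGroup θ.PartialL2 := inferInstanceAs (AddCommGroup θ.partialSubmodule)
instance : Module C(X, ℂ) θ.PartialL2 := inferInstanceAs (Module C(X, ℂ) θ.partialSubmodule)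
instance : Module ℂ θ.PartialL2 := inferInstanceAs (Module ℂ θ.partialSubmodule)
instance : FunLike θ.PartialL2 G C(X, ℂ) where
  coe ξ := ξ.1
  coe_injective _ _ h := Subtype.ext h

@[ext] theorem ext {ξ η : θ.PartialL2} (h : ∀ g, ξ g = η g) : ξ = η := DFunLike.ext _ _ h

theorem apply_mem (ξ : θ.PartialL2) (g : G) : ξ g ∈ θ.domainIdeal g := ξ.2.1 g
theorem summable_self (ξ : θ.PartialL2) : Summable fun g => star (ξ g) * ξ g := ξ.2.2
theorem summable (ξ η : θ.PartialL2) : Summable fun g => star (ξ g) * η g :=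
  summable_inner ξ.2.2 η.2.2

theorem add_apply (ξ η : θ.PartialL2) (g : G) : (ξ + η) g = ξ g + η g := rfl
theorem smul_apply (z : ℂ) (ξ : θ.PartialL2) (g : G) : (z • ξ) g = z • ξ g := rfl
theorem smul_apply' (f : C(X, ℂ)) (ξ : θ.PartialL2) (g : G) : (f • ξ) g = f * ξ g := rfl
theorem zero_apply (g : G) : (0 : θ.PartialL2) g = 0 := rfl

/-- The inner product `⟨ξ, η⟩ = ∑_g ξ(g)* η(g)`. -/
instance : Inner C(X, ℂ) θ.PartialL2 where
  inner ξ η := ∑' g, star (ξ g) * η g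

theorem inner_def (ξ η : θ.PartialL2) : inner C(X, ℂ) ξ η = ∑' g, star (ξ g) * η g := rfl

theorem hasSum_inner (ξ η : θ.PartialL2) :
    HasSum (fun g => star (ξ g) * η g) (inner C(X, ℂ) ξ η) := (summable ξ η).hasSum

/-- The norm `‖ξ‖ = ‖⟨ξ, ξ⟩‖^(1/2)`. -/
instance : Norm θ.PartialL2 := CStarModule.norm C(X, ℂ)

instance : CStarModule C(X, ℂ) θ.PartialL2 where
  inner_add_right {ξ η ζ} := by
    simp only [inner_def, add_apply, mul_add]
    exact (summable ξ η).tsum_add (summable ξ ζ)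
  inner_self_nonneg {ξ} := hasSum_mono hasSum_zero (hasSum_inner ξ ξ) fun g =>
    star_mul_self_nonneg _
  inner_self {ξ} := by
    classical
    refine ⟨fun h => ?_, fun h => ?_⟩
    · ext1 g
      have h1 := hasSum_inner ξ ξ
      rw [h] at h1
      have h2 : star (ξ g) * ξ g ≤ 0 := by
        refine hasSum_mono (hasSum_ite_eq g (star (ξ g) * ξ g)) h1 fun k => ?_
        split_ifs with hk
        · rw [hk]
        · exact star_mul_self_nonneg _
      have h3 := le_antisymm h2 (star_mul_self_nonneg _)
      exact CStarRing.star_mul_self_eq_zero_iff _ |>.1 h3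
    · subst h
      simp [inner_def, zero_apply]
  inner_op_smul_right {f ξ η} := by
    simp only [inner_def, smul_apply', ← (summable ξ η).tsum_mul_left f]
    exact tsum_congr fun g => by ring
  inner_smul_right_complex {z ξ η} := by
    simp only [inner_def, smul_apply, mul_smul_comm]
    exact (summable ξ η).tsum_const_smul z
  star_inner ξ η := by
    rw [inner_def, tsum_star]
    exact tsum_congr fun g => by rw [star_mul, star_star]
  norm_eq_sqrt_norm_inner_self _ := rfl

instance : NormedAddCommGroup θ.PartialL2 := CStarModule.normedAddCommGroup C(X, ℂ)

instance : NormedSpace ℂ θ.PartialL2 := .ofCore (CStarModule.normedSpaceCore C(X, ℂ))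

theorem norm_le_of_inner_le {ξ η : θ.PartialL2} {c : ℝ} (hc : 0 ≤ c)
    (h : inner C(X, ℂ) ξ ξ ≤ (c ^ 2) • inner C(X, ℂ) η η) : ‖ξ‖ ≤ c * ‖η‖ := by
  have h0 : 0 ≤ inner C(X, ℂ) ξ ξ :=
    CStarModule.inner_self_nonneg (A := C(X, ℂ)) (E := θ.PartialL2)
  have h1 := CStarAlgebra.norm_le_norm_of_nonneg_of_le h0 h
  rw [norm_smul, ← CStarModule.norm_sq_eq C(X, ℂ), ← CStarModule.norm_sq_eq C(X, ℂ), Real.norm_of_nonneg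
    (by positivity), ← mul_pow] at h1
  exact (pow_le_pow_iff_left₀ (norm_nonneg _) (by positivity) (by simp)).mp h1

end PartialL2

open PartialL2

theorem translate_bound (f : C(X, ℂ)) (ξ : θ.PartialL2) (g : G) :
    star (θ.translate g f * ξ g) * (θ.translate g f * ξ g)
      ≤ (‖f‖ ^ 2) • (star (ξ g) * ξ g) := by
  rw [ContinuousMap.le_def]
  intro x
  have h1 : ‖θ.translate g f x‖ ≤ ‖f‖ := by
    by_cases hx : g ∈ θ.Q x
    · rw [translate_of_mem hx]
      exact f.norm_coe_le_norm _
    · rw [translate_of_notMem hx, norm_zero]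
      exact norm_nonneg _
  simp only [ContinuousMap.mul_apply, ContinuousMap.star_apply, ContinuousMap.smul_apply,
    RCLike.star_def, Complex.conj_mul', Complex.real_smul, norm_mul]
  norm_cast
  rw [mul_pow]
  gcongr

theorem summable_tau (f : C(X, ℂ)) (ξ : θ.PartialL2) :
    Summable fun g => star (θ.translate g f * ξ g) * (θ.translate g f * ξ g) :=
  summable_of_nonneg_of_le (fun _ => star_mul_self_nonneg _) (translate_bound f ξ)
    ((summable_self ξ).const_smul _)

theorem translate_restrict (g : G) (f : C(X, ℂ)) :
    θ.translate g (θ.restrict g⁻¹ f) = θ.translate g f := by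
  ext x
  by_cases hx : g ∈ θ.Q x
  · rw [translate_of_mem hx, translate_of_mem hx]
    exact restrict_of_mem (ofMem (x, g) hx).inv.2 f
  · rw [translate_of_notMem hx, translate_of_notMem hx]

theorem alphaHat_restrict (g : G) (f : C(X, ℂ)) :
    (θ.alphaHat g ⟨θ.restrict g⁻¹ f, restrict_mem g⁻¹ f⟩ : C(X, ℂ)) = θ.translate g f :=
  translate_restrict g f

/-- `τ(f)` as a linear map: `(τ(f) ξ)(g) = α̂_g(f) ξ(g)`, where `f` is restricted to `X_{g⁻¹}`. -/
def tauLinear (θ : InjectiveAction P X) (f : C(X, ℂ)) : θ.PartialL2 →ₗ[ℂ] θ.PartialL2 where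
  toFun ξ := ⟨fun g => θ.alphaHat g ⟨θ.restrict g⁻¹ f, restrict_mem g⁻¹ f⟩ * ξ g, by
    simp only [alphaHat_restrict]
    exact ⟨fun g => mul_mem (translate_mem g f) (apply_mem ξ g), summable_tau f ξ⟩⟩
  map_add' ξ η := by ext1 g; exact mul_add _ (ξ g) (η g)
  map_smul' z ξ := by ext1 g; exact mul_smul_comm z _ (ξ g)

theorem tauLinear_apply (f : C(X, ℂ)) (ξ : θ.PartialL2) (g : G) :
    θ.tauLinear f ξ g = θ.translate g f * ξ g :=
  congrArg (· * ξ g) (alphaHat_restrict g f)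

theorem tauLinear_bound (f : C(X, ℂ)) (ξ : θ.PartialL2) : ‖θ.tauLinear f ξ‖ ≤ ‖f‖ * ‖ξ‖ := by
  refine norm_le_of_inner_le (norm_nonneg _) ?_
  refine hasSum_mono (hasSum_inner _ _) ((hasSum_inner ξ ξ).const_smul _) fun g => ?_
  rw [tauLinear_apply]
  exact translate_bound f ξ g

theorem inner_tauLinear (f : C(X, ℂ)) (ξ η : θ.PartialL2) :
    inner C(X, ℂ) (θ.tauLinear f ξ) η = inner C(X, ℂ) ξ (θ.tauLinear (star f) η) := by
  simp only [inner_def, tauLinear_apply]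
  refine tsum_congr fun g => ?_
  ext x
  by_cases hx : g ∈ θ.Q x
  · simp only [ContinuousMap.mul_apply, ContinuousMap.star_apply, translate_of_mem hx, star_mul]
    ring
  · simp [translate_of_notMem hx]

/-- The representation `τ` of `C(X)` on `F`. -/
def tau (θ : InjectiveAction P X) (f : C(X, ℂ)) : Adjointable C(X, ℂ) θ.PartialL2 :=
  Adjointable.mk ((θ.tauLinear f).mkContinuous ‖f‖ (tauLinear_bound f))
    ((θ.tauLinear (star f)).mkContinuous ‖star f‖ (tauLinear_bound (star f)))
    (inner_tauLinear f)

theorem restrict_bound (g : G) (f : C(X, ℂ)) :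
    star (θ.restrict g f) * θ.restrict g f ≤ star f * f := by
  rw [ContinuousMap.le_def]
  intro x
  by_cases hx : g ∈ θ.Q x
  · simp [restrict_of_mem hx]
  · simp only [ContinuousMap.mul_apply, ContinuousMap.star_apply, restrict_of_notMem hx, mul_zero]
    exact star_mul_self_nonneg _

/-- `v_h` as a linear map: `(v_h ξ)(g)` is the restriction of `ξ(g h)` to `X_g ∩ X_{g h}`; it is
zero outside of this set. Recall that `ξ(g h)` already vanishes outside of `X_{g h}`. -/
def vLinear (θ : InjectiveAction P X) (h : G) : θ.PartialL2 →ₗ[ℂ] θ.PartialL2 where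
  toFun ξ := ⟨fun g => θ.restrict g (ξ (g * h)), fun g => restrict_mem g _,
    summable_of_nonneg_of_le (fun _ => star_mul_self_nonneg _)
      (fun g => restrict_bound g (ξ (g * h)))
      ((Equiv.mulRight h).summable_iff.2 (summable_self ξ))⟩
  map_add' ξ η := by
    ext g x
    change θ.restrict g _ x = θ.restrict g _ x + θ.restrict g _ x
    by_cases hx : g ∈ θ.Q x
    · simp [restrict_of_mem hx, PartialL2.add_apply]
    · simp [restrict_of_notMem hx]
  map_smul' z ξ := by
    ext g x
    change θ.restrict g _ x = z * θ.restrict g _ x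
    by_cases hx : g ∈ θ.Q x
    · simp [restrict_of_mem hx, PartialL2.smul_apply]
    · simp [restrict_of_notMem hx]

theorem vLinear_apply (h : G) (ξ : θ.PartialL2) (g : G) :
    θ.vLinear h ξ g = θ.restrict g (ξ (g * h)) := rfl

theorem vLinear_bound (h : G) (ξ : θ.PartialL2) : ‖θ.vLinear h ξ‖ ≤ 1 * ‖ξ‖ := by
  refine norm_le_of_inner_le zero_le_one ?_
  rw [one_pow, one_smul]
  exact hasSum_mono (hasSum_inner _ _) ((Equiv.mulRight h).hasSum_iff.2 (hasSum_inner ξ ξ))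
    fun g => restrict_bound g (ξ (g * h))

theorem inner_vLinear (h : G) (ξ η : θ.PartialL2) :
    inner C(X, ℂ) (θ.vLinear h ξ) η = inner C(X, ℂ) ξ (θ.vLinear h⁻¹ η) := by
  simp only [inner_def, vLinear_apply]
  rw [← (Equiv.mulRight h).tsum_eq fun k => star (ξ k) * θ.restrict k (η (k * h⁻¹))]
  refine tsum_congr fun g => ?_
  ext x
  simp only [Equiv.coe_mulRight, mul_inv_cancel_right, ContinuousMap.mul_apply,
    ContinuousMap.star_apply]
  by_cases hx : g ∈ θ.Q x
  · by_cases hx' : g * h ∈ θ.Q x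
    · rw [restrict_of_mem hx, restrict_of_mem hx']
    · rw [restrict_of_mem hx, restrict_of_notMem hx', apply_mem ξ (g * h) x hx']
      simp
  · by_cases hx' : g * h ∈ θ.Q x
    · rw [restrict_of_notMem hx, restrict_of_mem hx', apply_mem η g x hx]
      simp
    · rw [restrict_of_notMem hx, restrict_of_notMem hx']
      simp

/-- The partial isometry `v_h` on `F`. -/
def v (θ : InjectiveAction P X) (h : G) : Adjointable C(X, ℂ) θ.PartialL2 :=
  Adjointable.mk ((θ.vLinear h).mkContinuous 1 (vLinear_bound h))
    ((θ.vLinear h⁻¹).mkContinuous 1 (vLinear_bound h⁻¹)) (inner_vLinear h)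

/-- The reduced partial crossed product `C(X) ⋊_r G`: the C⋆-algebra generated by all `τ(f)` and
`v_g` in `𝓛(F)`. -/
def reducedPartialCrossedProduct (θ : InjectiveAction P X) :
    NonUnitalStarSubalgebra ℂ (Adjointable C(X, ℂ) θ.PartialL2) :=
  Adjointable.cstarGenerated (Set.range θ.tau ∪ Set.range θ.v)

end InjectiveAction

end

/-! A function in C_c(X ⋊ P) is a finitely supported family of slices x ↦ ξ(x, g), the slice at g
living on X_g. Since X_g is clopen, slices extended by zero are continuous on X, and the family is
an element of F. The inner products agree, both being the sum over g of conj(ξ(x, g)) η(x, g)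
(`inner_sliceLinear`). Finitely supported families are dense in F (`denseRange_sliceIsometry`) and F
is complete, so the slice map extends from C_c(X ⋊ P) to a unitary Φ of its completion onto F.

It remains to match generators under T ↦ Φ T Φ*. Substituting h = g k in the formula for π̃ gives
(π̃(f) ξ)(x, g) = ∑_k f(u(x, g), k) ξ(x, g k). Here v_k replaces the slice at g by the one at g k,
and τ(f_k), for f_k = f(·, k) extended by zero, multiplies by f_k ∘ u(·, g). Hence Φ π̃(f) Φ* = ∑_k
τ(f_k) v_k, a finite sum (`conjSlice_regularRep`). Conversely, τ(f) is the image of π̃ of the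
function f placed on the unit space X × {e}, and v_h is the image of π̃ of the characteristic
function of X_h × {h} (`conjSlice_regularRep_tau`, `conjSlice_regularRep_v`).

Conjugation by Φ is a bicontinuous `*`-isomorphism 𝓛(l²(X ⋊ P)) ≃ 𝓛(F), so the two inclusions
between generators pass to the closed `*`-algebras they generate. -/

noncomputable section

/-! ### Conjugation of adjointable operators by a unitary -/

namespace Adjointable

section Conj

variable {A E F : Type*} [CStarAlgebra A] [PartialOrder A] [StarOrderedRing A]
  [NormedAddCommGroup E] [NormedSpace ℂ E] [Module A E] [CStarModule A E]
  [NormedAddCommGroup F] [NormedSpace ℂ F] [Module A F] [CStarModule A F]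

theorem ext_apply {T S : Adjointable A E} (h : ∀ x, T x = S x) : T = S :=
  Subtype.ext (ContinuousLinearMap.ext h)

/-- Conjugation `T ↦ U T U⁻¹` of adjointable operators by a map `U` preserving inner products. -/
def conjFun (U : E ≃L[ℂ] F) (hU : ∀ x y, inner A (U x) (U y) = inner A x y)
    (T : Adjointable A E) : Adjointable A F :=
  mk ((U : E →L[ℂ] F).comp (T.1.comp (U.symm : F →L[ℂ] E)))
    ((U : E →L[ℂ] F).comp ((star T).1.comp (U.symm : F →L[ℂ] E))) fun x y => by
      -- Both sides are pulled back along U to inner products in E, where T and its adjoint are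
      -- exchanged.
      have h1 := hU (T (U.symm x)) (U.symm y)
      have h2 := hU (U.symm x) (star T (U.symm y))
      rw [U.apply_symm_apply] at h1 h2
      exact h1.trans ((inner_star_right T _ _).symm.trans h2.symm)

theorem conjFun_apply (U : E ≃L[ℂ] F) (hU : ∀ x y, inner A (U x) (U y) = inner A x y)
    (T : Adjointable A E) (y : F) : conjFun U hU T y = U (T (U.symm y)) := rfl

/-- Composition with a fixed bounded operator on either side is norm continuous. This is what lets
conjugation pass to the norm closure in `cstarGenerated`. -/
theorem continuous_conjFun (U : E ≃L[ℂ] F) (hU : ∀ x y, inner A (U x) (U y) = inner A x y) :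
    Continuous (conjFun U hU : Adjointable A E → Adjointable A F) :=
  Continuous.subtype_mk (continuous_const.clm_comp
    ((continuous_subtype_val (p := fun T => T ∈ adjointableSubalgebra A E)).clm_comp
      continuous_const)) _

theorem inner_symm_symm (U : E ≃L[ℂ] F) (hU : ∀ x y, inner A (U x) (U y) = inner A x y) (x y : F) :
    inner A (U.symm x) (U.symm y) = inner A x y := by
  rw [← hU, U.apply_symm_apply, U.apply_symm_apply]

/-- Conjugation by a unitary as a `*`-isomorphism `𝓛(E) ≃ 𝓛(F)`. -/
def conj (U : E ≃L[ℂ] F) (hU : ∀ x y, inner A (U x) (U y) = inner A x y) :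
    Adjointable A E ≃⋆ₐ[ℂ] Adjointable A F where
  toFun := conjFun U hU
  invFun := conjFun U.symm (inner_symm_symm U hU)
  left_inv T := ext_apply fun x => by simp [conjFun_apply]
  right_inv T := ext_apply fun x => by simp [conjFun_apply]
  map_mul' T S := ext_apply fun x => by
    change U (T (S (U.symm x))) = U (T (U.symm (U (S (U.symm x)))))
    rw [U.symm_apply_apply]
  map_add' T S := ext_apply fun x => U.map_add (T (U.symm x)) (S (U.symm x))
  -- By uniqueness of adjoints it is enough that U T* U⁻¹ is adjoint to U T U⁻¹.
  map_star' T := eq_star fun x y => by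
    have h1 := hU (T (U.symm x)) (U.symm y)
    have h2 := hU (U.symm x) (star T (U.symm y))
    rw [U.apply_symm_apply] at h1 h2
    exact h1.trans ((inner_star_right T _ _).symm.trans h2.symm)
  map_smul' c T := ext_apply fun x => U.map_smul c (T (U.symm x))

/-- The preimage of a closed `*`-subalgebra under a continuous `*`-homomorphism is again a closed
`*`-subalgebra, so it contains the generated algebra once it contains the generators. -/
theorem cstarGenerated_le_comap (e : Adjointable A E ≃⋆ₐ[ℂ] Adjointable A F) (he : Continuous e)
    {s : Set (Adjointable A E)} {t : Set (Adjointable A F)}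
    (h : ∀ T ∈ s, e T ∈ cstarGenerated t) {T : Adjointable A E} (hT : T ∈ cstarGenerated s) :
    e T ∈ cstarGenerated t := by
  have h1 : cstarGenerated s ≤
      (cstarGenerated t).comap (e : Adjointable A E →⋆ₙₐ[ℂ] Adjointable A F) := by
    refine NonUnitalStarSubalgebra.topologicalClosure_minimal _ ?_ ?_
    · exact NonUnitalStarAlgebra.adjoin_le h
    · exact (NonUnitalStarSubalgebra.isClosed_topologicalClosure _).preimage he
  exact h1 hT

/-- A bicontinuous `*`-isomorphism matching up generators restricts to the generated
C⋆-algebras. -/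
def cstarGeneratedEquiv (e : Adjointable A E ≃⋆ₐ[ℂ] Adjointable A F) (he : Continuous e)
    (he' : Continuous e.symm) {s : Set (Adjointable A E)} {t : Set (Adjointable A F)}
    (h : ∀ T ∈ s, e T ∈ cstarGenerated t) (h' : ∀ T ∈ t, e.symm T ∈ cstarGenerated s) :
    cstarGenerated s ≃⋆ₐ[ℂ] cstarGenerated t where
  toFun T := ⟨e T, cstarGenerated_le_comap e he h T.2⟩
  invFun T := ⟨e.symm T, cstarGenerated_le_comap e.symm he' h' T.2⟩
  left_inv T := Subtype.ext (e.symm_apply_apply T.1)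
  right_inv T := Subtype.ext (e.apply_symm_apply T.1)
  map_mul' T S := Subtype.ext (map_mul e T.1 S.1)
  map_add' T S := Subtype.ext (map_add e T.1 S.1)
  map_star' T := Subtype.ext (map_star e T.1)
  map_smul' c T := Subtype.ext (map_smul e c T.1)

end Conj

end Adjointable

namespace InjectiveAction
open TransGroupoid

variable {G X : Type*} [Group G] {P : Submonoid G} [TopologicalSpace X] {θ : InjectiveAction P X}
  [TopologicalSpace G] [DiscreteTopology G] [CompactSpace X] [T2Space X] [IsRightOre P]

/-! ### Norm estimates and completeness of F -/

namespace PartialL2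

/-- The partial sums of a series of positive elements lie below its limit, and the norm is monotone
on positive elements. -/
theorem norm_sum_le (ξ : θ.PartialL2) (s : Finset G) :
    ‖∑ g ∈ s, star (ξ g) * ξ g‖ ≤ ‖ξ‖ ^ 2 := by
  rw [CStarModule.norm_sq_eq C(X, ℂ)]
  exact CStarAlgebra.norm_le_norm_of_nonneg_of_le
    (Finset.sum_nonneg fun g _ => star_mul_self_nonneg _)
    (sum_le_hasSum s (fun g _ => star_mul_self_nonneg _) (hasSum_inner ξ ξ))

/-- Norms of partial sums converge to the norm of ⟨ξ, ξ⟩. With `norm_sum_le` this turns norm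
estimates in F into estimates uniform over finite subsets of G. -/
theorem norm_sq_le_of_sum_le (ξ : θ.PartialL2) {c : ℝ}
    (h : ∀ s : Finset G, ‖∑ g ∈ s, star (ξ g) * ξ g‖ ≤ c) : ‖ξ‖ ^ 2 ≤ c := by
  rw [CStarModule.norm_sq_eq C(X, ℂ)]
  exact le_of_tendsto (Filter.Tendsto.norm (hasSum_inner ξ ξ)) (Filter.Eventually.of_forall h)

/-- Evaluation at g is contractive, so a Cauchy sequence in F is Cauchy in each coordinate. -/
theorem norm_apply_le (ξ : θ.PartialL2) (g : G) : ‖ξ g‖ ≤ ‖ξ‖ := by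
  have h := norm_sum_le ξ {g}
  rw [Finset.sum_singleton, CStarRing.norm_star_mul_self, ← sq] at h
  exact (pow_le_pow_iff_left₀ (norm_nonneg _) (norm_nonneg _) two_ne_zero).mp h

theorem sub_apply (ξ η : θ.PartialL2) (g : G) : (ξ - η) g = ξ g - η g := rfl

/-- The parallelogram law |a + b|² + |a - b|² = 2|a|² + 2|b|² gives |a + b|² ≤ 2(|a|² + |b|²) as
positive elements. It serves in place of the triangle inequality before the families involved are
known to lie in F. -/
theorem norm_sum_star_mul_self_add_le {ι : Type*} (a b : ι → C(X, ℂ)) (s : Finset ι) :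
    ‖∑ i ∈ s, star (a i + b i) * (a i + b i)‖
      ≤ 2 * (‖∑ i ∈ s, star (a i) * a i‖ + ‖∑ i ∈ s, star (b i) * b i‖) := by
  have h : ∑ i ∈ s, star (a i + b i) * (a i + b i)
      ≤ (2 : ℝ) • (∑ i ∈ s, star (a i) * a i + ∑ i ∈ s, star (b i) * b i) := by
    rw [← Finset.sum_add_distrib, Finset.smul_sum]
    refine Finset.sum_le_sum fun i _ => ?_
    rw [← sub_nonneg]
    convert star_mul_self_nonneg (a i - b i) using 1
    simp only [star_add, star_sub, two_smul]
    ring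
  refine (CStarAlgebra.norm_le_norm_of_nonneg_of_le
    (Finset.sum_nonneg fun i _ => star_mul_self_nonneg _) h).trans ?_
  rw [norm_smul, Real.norm_of_nonneg zero_le_two]
  gcongr
  exact norm_add_le _ _

/-- The classical argument for ℓ²: take limits coordinatewise, bound the distance to them uniformly
over finite sums, and deduce that the limit family lies in F. Completeness is what makes the
extended slice map surjective. -/
instance : CompleteSpace θ.PartialL2 := by
  refine Metric.complete_of_cauchySeq_tendsto fun u hu => ?_
  have hco : ∀ g, ∃ l, Filter.Tendsto (fun n => u n g) Filter.atTop (nhds l) := fun g => by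
    refine cauchySeq_tendsto_of_complete ?_
    rw [Metric.cauchySeq_iff] at hu ⊢
    intro ε hε
    obtain ⟨N, hN⟩ := hu ε hε
    refine ⟨N, fun m hm n hn => lt_of_le_of_lt ?_ (hN m hm n hn)⟩
    rw [dist_eq_norm, dist_eq_norm, ← sub_apply]
    exact norm_apply_le _ g
  choose l hl using hco
  -- Let m → ∞ in the Cauchy estimate for u m - u n. Only finite sums are used, since the limit
  -- family is not yet known to be square summable.
  have hlim : ∀ ε > 0, ∃ N, ∀ n ≥ N, ∀ s : Finset G,
      ‖∑ g ∈ s, star (l g - u n g) * (l g - u n g)‖ ≤ ε ^ 2 := by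
    intro ε hε
    obtain ⟨N, hN⟩ := Metric.cauchySeq_iff.1 hu ε hε
    refine ⟨N, fun n hn s => ?_⟩
    have ht : Filter.Tendsto (fun m => ‖∑ g ∈ s, star (u m g - u n g) * (u m g - u n g)‖)
        Filter.atTop (nhds ‖∑ g ∈ s, star (l g - u n g) * (l g - u n g)‖) :=
      (tendsto_finsetSum _ fun g _ => (((hl g).sub_const _).star.mul ((hl g).sub_const _))).norm
    refine le_of_tendsto ht ?_
    filter_upwards [Filter.eventually_ge_atTop N] with m hm
    refine (norm_sum_le (u m - u n) s).trans ?_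
    have := hN m hm n hn
    rw [dist_eq_norm] at this
    gcongr
  have hsum : Summable fun g => star (l g) * l g := by
    rw [summable_iff_vanishing_norm]
    intro ε hε
    -- With this radius the finite sums for l - u N are at most ε/8, as are those for u N outside s;
    -- the factor 2 of the parallelogram bound then gives ε/2 < ε.
    have hδ : 0 < √(ε / 8) := by positivity
    obtain ⟨N, hN⟩ := hlim _ hδ
    obtain ⟨s, hs⟩ := summable_iff_vanishing_norm.1 (summable_self (u N)) (ε / 8) (by positivity)
    refine ⟨s, fun t ht => ?_⟩
    have h1 := norm_sum_star_mul_self_add_le (fun g => l g - u N g) (fun g => u N g) t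
    simp only [sub_add_cancel] at h1
    have h2 := hN N le_rfl t
    rw [Real.sq_sqrt (by positivity)] at h2
    linarith [hs t ht]
  -- Vanishing at a point x survives limits in C(X), since evaluation at x is continuous.
  have hdom : ∀ g, l g ∈ θ.domainIdeal g := fun g x hx => by
    refine tendsto_nhds_unique
      (((continuous_eval_const x).tendsto (l g)).comp (hl g)) ?_
    exact tendsto_const_nhds.congr fun n => ((u n).apply_mem g x hx).symm
  let L : θ.PartialL2 := ⟨l, hdom, hsum⟩
  refine ⟨L, Metric.tendsto_atTop.2 fun ε hε => ?_⟩
  -- Halving ε restores the strict inequality lost in the limit.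
  obtain ⟨N, hN⟩ := hlim (ε / 2) (by positivity)
  refine ⟨N, fun n hn => ?_⟩
  rw [dist_comm, dist_eq_norm]
  have h1 := norm_sq_le_of_sum_le (L - u n) (hN n hn)
  have h2 := (pow_le_pow_iff_left₀ (norm_nonneg _) (by positivity) two_ne_zero).mp h1
  linarith

instance : UniformContinuousConstSMul C(X, ℂ) θ.PartialL2 := CStarModule.uniformContinuousConstSMul

end PartialL2

open PartialL2

/-! ### The slice map from C_c(X ⋊ P) into F -/

/-- Slices outside the finite cocycle support of ξ vanish, so the series is a finite sum and its
convergence in C(X) is immediate. This yields both the membership of slice families in F and the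
equality of the inner products. -/
theorem hasSum_zeroExt_inner (ξ η : θ.CcL2) (u v : G → C(X, ℂ))
    (hu : ∀ g x, u g x = θ.zeroExt ξ (x, g)) (hv : ∀ g x, v g x = θ.zeroExt η (x, g)) :
    HasSum (fun g => star (u g) * v g) (inner C(X, ℂ) ξ η) := by
  have h : inner C(X, ℂ) ξ η = ∑ g ∈ cocycleSupport ((CcL2.of θ).symm ξ), star (u g) * v g := by
    ext x
    rw [CcL2.inner_apply ξ η x _ subset_rfl, ContinuousMap.sum_apply]
    exact Finset.sum_congr rfl fun g _ => by simp [hu, hv]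
  rw [h]
  refine hasSum_sum_of_ne_finset_zero fun g hg => ?_
  have : u g = 0 := by
    ext x
    rw [hu]
    exact zeroExt_eq_zero hg
  simp [this]

/-- The slice `x ↦ ξ(x, g)`, extended by zero. -/
def slice (ξ : θ.CcL2) (g : G) : C(X, ℂ) :=
  ⟨fun x => θ.zeroExt ξ (x, g), continuous_zeroExt_slice ξ.continuous g⟩

theorem slice_mem (ξ : θ.CcL2) (g : G) : slice ξ g ∈ θ.domainIdeal g :=
  fun _ hx => zeroExt_of_notMem _ _ hx

/-- The map `C_c(X ⋊ P) → F` sending a function to the family of its slices. -/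
def sliceLinear (θ : InjectiveAction P X) : θ.CcL2 →ₗ[ℂ] θ.PartialL2 where
  toFun ξ := ⟨slice ξ, slice_mem ξ, (hasSum_zeroExt_inner ξ ξ (slice ξ) (slice ξ)
    (fun _ _ => rfl) fun _ _ => rfl).summable⟩
  map_add' ξ η := by ext g x; exact CcL2.zeroExt_add ξ η _
  map_smul' z ξ := by ext g x; exact CcL2.zeroExt_smul z ξ _

theorem sliceLinear_apply (ξ : θ.CcL2) (g : G) (x : X) :
    θ.sliceLinear ξ g x = θ.zeroExt ξ (x, g) := rfl

theorem inner_sliceLinear (ξ η : θ.CcL2) :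
    inner C(X, ℂ) (θ.sliceLinear ξ) (θ.sliceLinear η) = inner C(X, ℂ) ξ η :=
  (hasSum_zeroExt_inner ξ η (slice ξ) (slice η) (fun _ _ => rfl) fun _ _ => rfl).tsum_eq

theorem sliceLinear_smul (f : C(X, ℂ)) (ξ : θ.CcL2) :
    θ.sliceLinear (f • ξ) = f • θ.sliceLinear ξ := by
  ext g x
  exact (CcL2.zeroExt_smul' f ξ (x, g)).trans (mul_comm _ _)

/-- `sliceLinear` as a linear isometry. -/
def sliceIsometry (θ : InjectiveAction P X) : θ.CcL2 →ₗᵢ[ℂ] θ.PartialL2 where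
  toLinearMap := θ.sliceLinear
  norm_map' ξ := by
    rw [CStarModule.norm_eq_sqrt_norm_inner_self (A := C(X, ℂ)) (θ.sliceLinear ξ),
      CStarModule.norm_eq_sqrt_norm_inner_self (A := C(X, ℂ)) ξ, inner_sliceLinear]

/-! ### Functions with prescribed slices, and density -/

/-- The function on `X ⋊ P` with slices `w g` for `g ∈ s`, and zero elsewhere. -/
def ofSlices (θ : InjectiveAction P X) (w : G → C(X, ℂ)) (s : Finset G) :
    C_c(θ.TransGroupoid, ℂ) where
  toFun γ := (s : Set G).indicator (fun g => w g γ.range) γ.cocycle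
  continuous_toFun := by
    -- Continuity is checked on X × G, where it may be tested on each slice X × {g} because G is
    -- discrete.
    have h : Continuous fun p : X × G => (s : Set G).indicator (fun g => w g p.1) p.2 := by
      rw [continuous_prod_of_discrete_right]
      intro g
      by_cases hg : g ∈ s
      · simpa [hg] using (w g).continuous
      · simpa [hg] using continuous_const
    exact h.comp continuous_subtype_val
  hasCompactSupport' := hasCompactSupport_of_finite s fun γ h => by
    simpa using Set.mem_of_indicator_ne_zero h

theorem ofSlices_apply (w : G → C(X, ℂ)) (s : Finset G) (γ : θ.TransGroupoid) :
    θ.ofSlices w s γ = (s : Set G).indicator (fun g => w g γ.range) γ.cocycle := rfl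

/-- Only the values of w g on X_g enter, so w g need not lie in the ideal C(X_g). This allows
constant families `fun _ => f` below. -/
theorem zeroExt_ofSlices_of_mem {w : G → C(X, ℂ)} {s : Finset G} {x : X} {g : G}
    (hg : g ∈ s) (hx : g ∈ θ.Q x) : θ.zeroExt (θ.ofSlices w s) (x, g) = w g x := by
  rw [zeroExt_of_mem _ (x, g) hx, ofSlices_apply]
  exact Set.indicator_of_mem (Finset.mem_coe.2 hg) _

theorem zeroExt_ofSlices_of_notMem {w : G → C(X, ℂ)} {s : Finset G} {x : X} {g : G}
    (hg : g ∉ s) : θ.zeroExt (θ.ofSlices w s) (x, g) = 0 := by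
  unfold zeroExt
  split_ifs with hx
  · rw [ofSlices_apply]
    exact Set.indicator_of_notMem (fun h => hg (Finset.mem_coe.1 h)) _
  · rfl

/-- Truncating ξ to a finite set s leaves a tail whose norm is controlled by the convergence of ∑
|ξ(g)|². -/
theorem denseRange_sliceIsometry (θ : InjectiveAction P X) : DenseRange θ.sliceIsometry := by
  classical
  intro ξ
  rw [Metric.mem_closure_range_iff]
  intro ε hε
  obtain ⟨s, hs⟩ := summable_iff_vanishing_norm.1 (summable_self ξ) ((ε / 2) ^ 2) (by positivity)
  refine ⟨CcL2.of θ (θ.ofSlices ξ s), ?_⟩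
  rw [dist_eq_norm]
  have h0 : ∀ g ∈ s, (ξ - θ.sliceIsometry (CcL2.of θ (θ.ofSlices ξ s))) g = 0 := fun g hg => by
    ext x
    by_cases hx : g ∈ θ.Q x
    · exact sub_eq_zero.2 (zeroExt_ofSlices_of_mem (w := ξ) hg hx).symm
    -- Off X_g every element of F vanishes.
    · exact apply_mem (ξ - θ.sliceIsometry _) g x hx
  have h1 : ∀ g ∉ s, (ξ - θ.sliceIsometry (CcL2.of θ (θ.ofSlices ξ s))) g = ξ g := fun g hg => by
    ext x
    change ξ g x - θ.zeroExt (θ.ofSlices ξ s) (x, g) = ξ g x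
    rw [zeroExt_ofSlices_of_notMem hg, sub_zero]
  have h2 : ‖ξ - θ.sliceIsometry (CcL2.of θ (θ.ofSlices ξ s))‖ ^ 2 ≤ (ε / 2) ^ 2 := by
    refine norm_sq_le_of_sum_le _ fun t => ?_
    -- The difference vanishes on s and equals ξ elsewhere, so only the part of the sum over t \ s
    -- remains, and s was chosen to make it small.
    rw [← Finset.sum_subset (Finset.sdiff_subset (s := t) (t := s)) fun g hg hg' => by
      rw [h0 g (by simpa [hg] using hg'), mul_zero]]
    rw [Finset.sum_congr rfl fun g hg => by rw [h1 g (Finset.mem_sdiff.1 hg).2]]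
    exact (hs _ Finset.sdiff_disjoint).le
  have h3 := (pow_le_pow_iff_left₀ (norm_nonneg _) (by positivity) two_ne_zero).mp h2
  linarith

/-! ### The unitary from l²(X ⋊ P) onto F -/

/-- The extension of `sliceIsometry` to a unitary `l²(X ⋊ P) → F`. -/
def sliceUnitary (θ : InjectiveAction P X) : θ.L2 ≃ₗᵢ[ℂ] θ.PartialL2 :=
  -- The identity of C_c(X ⋊ P) is extended, the space being densely embedded both in its completion
  -- and, by slices, in F. Density on both sides makes the extension invertible.
  (LinearEquiv.refl ℂ θ.CcL2).extendOfIsometry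
    (UniformSpace.Completion.toComplₗᵢ (𝕜 := ℂ) (E := θ.CcL2)).toLinearMap
    θ.sliceIsometry.toLinearMap UniformSpace.Completion.denseRange_coe
    (denseRange_sliceIsometry θ)
    fun ξ => (θ.sliceIsometry.norm_map ξ).trans (UniformSpace.Completion.norm_coe ξ).symm

theorem sliceUnitary_coe (ξ : θ.CcL2) : θ.sliceUnitary (ξ : θ.L2) = θ.sliceLinear ξ :=
  LinearEquiv.extendOfIsometry_eq (LinearEquiv.refl ℂ θ.CcL2)
    (UniformSpace.Completion.toComplₗᵢ (𝕜 := ℂ) (E := θ.CcL2)).toLinearMap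
    θ.sliceIsometry.toLinearMap UniformSpace.Completion.denseRange_coe
    (denseRange_sliceIsometry θ) _ ξ

/-- Both sides are continuous in the pair (ξ, η) and agree on the dense image of C_c(X ⋊ P). -/
theorem inner_sliceUnitary (ξ η : θ.L2) :
    inner C(X, ℂ) (θ.sliceUnitary ξ) (θ.sliceUnitary η) = inner C(X, ℂ) ξ η := by
  have hc := CStarModule.continuous_completion_inner (A := C(X, ℂ)) (E := θ.CcL2)
  have hc' : Continuous (Function.uncurry (inner C(X, ℂ) (E := θ.PartialL2))) :=
    CStarModule.continuous_inner
  have hU : Continuous fun p : θ.L2 × θ.L2 => (θ.sliceUnitary p.1, θ.sliceUnitary p.2) :=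
    (θ.sliceUnitary.continuous.comp continuous_fst).prodMk
      (θ.sliceUnitary.continuous.comp continuous_snd)
  have h₁ := hc'.comp hU
  have h₂ : Continuous fun p : θ.L2 × θ.L2 =>
      inner C(X, ℂ) (θ.sliceUnitary p.1) (θ.sliceUnitary p.2) := h₁
  have h₃ : Continuous fun p : θ.L2 × θ.L2 => inner C(X, ℂ) p.1 p.2 := hc
  refine UniformSpace.Completion.induction_on₂ ξ η (isClosed_eq h₂ h₃) fun ξ η => ?_
  rw [sliceUnitary_coe, sliceUnitary_coe, CStarModule.completion_inner_coe, inner_sliceLinear]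

theorem sliceUnitary_smul (f : C(X, ℂ)) (ξ : θ.L2) :
    θ.sliceUnitary (f • ξ) = f • θ.sliceUnitary ξ := by
  have hU : Continuous θ.sliceUnitary := θ.sliceUnitary.continuous
  refine UniformSpace.Completion.induction_on ξ (isClosed_eq
    (hU.comp (continuous_const_smul f)) (hU.const_smul f)) fun ξ => ?_
  rw [← UniformSpace.Completion.coe_smul, sliceUnitary_coe, sliceUnitary_coe, sliceLinear_smul]

/-- `sliceUnitary` as an isomorphism of `C(X)`-modules. -/
def sliceModuleEquiv (θ : InjectiveAction P X) : θ.L2 ≃ₗ[C(X, ℂ)] θ.PartialL2 where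
  __ := θ.sliceUnitary.toLinearEquiv.toAddEquiv
  map_smul' := sliceUnitary_smul

/-- Conjugation of adjointable operators by `sliceUnitary`. -/
def conjSlice (θ : InjectiveAction P X) :
    Adjointable C(X, ℂ) θ.L2 ≃⋆ₐ[ℂ] Adjointable C(X, ℂ) θ.PartialL2 :=
  Adjointable.conj θ.sliceUnitary.toContinuousLinearEquiv inner_sliceUnitary

theorem conjSlice_apply (T : Adjointable C(X, ℂ) θ.L2) (ξ : θ.L2) :
    θ.conjSlice T (θ.sliceUnitary ξ) = θ.sliceUnitary (T ξ) :=
  congrArg (fun ζ => θ.sliceUnitary (T ζ)) (θ.sliceUnitary.symm_apply_apply ξ)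

theorem continuous_conjSlice : Continuous θ.conjSlice :=
  Adjointable.continuous_conjFun θ.sliceUnitary.toContinuousLinearEquiv inner_sliceUnitary

theorem continuous_conjSlice_symm : Continuous θ.conjSlice.symm :=
  Adjointable.continuous_conjFun θ.sliceUnitary.toContinuousLinearEquiv.symm
    (Adjointable.inner_symm_symm θ.sliceUnitary.toContinuousLinearEquiv inner_sliceUnitary)

/-! ### Generators under conjugation -/

/-- Both operators are bounded and slice families are dense in F, so an operator identity reduces to
a scalar identity at each (x, g). -/
theorem conjSlice_regularRep_eq {f : C_c(θ.TransGroupoid, ℂ)}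
    {S : Adjointable C(X, ℂ) θ.PartialL2}
    (h : ∀ (ξ : θ.CcL2) (g : G) (x : X),
      S (θ.sliceLinear ξ) g x = θ.zeroExt (convLinear f ξ) (x, g)) :
    θ.conjSlice (regularRep f) = S := by
  refine Adjointable.ext_apply fun ζ => ?_
  refine (denseRange_sliceIsometry θ).induction (P := fun ζ => θ.conjSlice (regularRep f) ζ = S ζ)
    ?_ (isClosed_eq (ContinuousLinearMap.continuous _) (ContinuousLinearMap.continuous _)) ζ
  rintro _ ⟨ξ, rfl⟩
  change θ.conjSlice (regularRep f) (θ.sliceLinear ξ) = S (θ.sliceLinear ξ)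
  have h1 : (regularRep f) (ξ : θ.L2) = ((convLinear f ξ : θ.CcL2) : θ.L2) :=
    ContinuousLinearMap.completion_apply_coe (convCLM f) ξ
  rw [← sliceUnitary_coe, conjSlice_apply, h1, sliceUnitary_coe, sliceUnitary_coe]
  ext g x
  exact (h ξ g x).symm

theorem tau_mul_v_apply (f : C(X, ℂ)) (h : G) (ξ : θ.CcL2) {g : G} {x : X} (hx : g ∈ θ.Q x) :
    (θ.tau f * θ.v h) (θ.sliceLinear ξ) g x
      = f (ofMem (x, g) hx).source * θ.zeroExt ξ (x, g * h) := by
  change θ.tauLinear f (θ.vLinear h (θ.sliceLinear ξ)) g x = _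
  rw [tauLinear_apply, ContinuousMap.mul_apply, translate_of_mem hx, vLinear_apply,
    restrict_of_mem hx, sliceLinear_apply]

/-- After the substitution h = g k in the convolution sum (`convFun_eq_sum'`), the summand for k is
τ(f_k) v_k applied to ξ. The sum is finite because f has compact support. -/
theorem conjSlice_regularRep (f : C_c(θ.TransGroupoid, ℂ)) :
    θ.conjSlice (regularRep f) =
      ∑ k ∈ cocycleSupport f, θ.tau (slice (CcL2.of θ f) k) * θ.v k := by
  refine conjSlice_regularRep_eq fun ξ g x => ?_
  by_cases hx : g ∈ θ.Q x
  · rw [zeroExt_of_mem _ (x, g) hx, convLinear_apply, convFun_eq_sum']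
    -- A finite sum of operators is evaluated termwise.
    have h1 : ∀ s : Finset G, (∑ k ∈ s, θ.tau (slice (CcL2.of θ f) k) * θ.v k :
        Adjointable C(X, ℂ) θ.PartialL2) (θ.sliceLinear ξ) g x = ∑ k ∈ s,
          (θ.tau (slice (CcL2.of θ f) k) * θ.v k) (θ.sliceLinear ξ) g x := fun s => by
      classical
      induction s using Finset.induction_on with
      | empty => rfl
      | insert k s hk ih => rw [Finset.sum_insert hk, Finset.sum_insert hk, ← ih]; rfl
    rw [h1]
    exact Finset.sum_congr rfl fun k _ => tau_mul_v_apply _ k ξ hx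
  · rw [zeroExt_of_notMem _ (x, g) hx]
    -- Off X_g the left side vanishes as well, being a value of an element of F.
    exact apply_mem _ g x hx

/-- A function carried by X × {h} leaves only one summand in the convolution, namely k = g h. Taking
h = e or f = 1 recovers the two kinds of generators of the crossed product. -/
theorem zeroExt_conv_ofSlices_singleton (f : C(X, ℂ)) (h : G) (ξ : θ.CcL2) {g : G} {x : X}
    (hx : g ∈ θ.Q x) :
    θ.zeroExt (convLinear (θ.ofSlices (fun _ => f) {h}) ξ) (x, g)
      = f (ofMem (x, g) hx).source * θ.zeroExt ξ (x, g * h) := by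
  rw [zeroExt_of_mem _ (x, g) hx, convLinear_apply, convFun_eq_finsum,
    finsum_eq_single _ (g * h) fun k hk => ?_]
  · change θ.zeroExt _ ((ofMem (x, g) hx).source, g⁻¹ * (g * h)) * θ.zeroExt ξ (x, g * h) = _
    -- If (x, g h) is in the groupoid, so is (u(x, g), h) = (x, g)⁻¹(x, g h), and the kernel takes
    -- the value f(u(x, g)). Otherwise ξ contributes zero on both sides.
    by_cases hgh : g * h ∈ θ.Q x
    · have hs : g⁻¹ * (g * h) ∈ θ.Q (ofMem (x, g) hx).source :=
        ((ofMem (x, g) hx).inv.mul (ofMem (x, g * h) hgh) (source_inv (ofMem (x, g) hx)).symm).2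
      rw [zeroExt_ofSlices_of_mem (by simp) hs]
    · rw [zeroExt_of_notMem _ (x, g * h) hgh, mul_zero, mul_zero]
  · refine mul_eq_zero_of_left (zeroExt_ofSlices_of_notMem fun hk' => hk ?_) _
    exact inv_mul_eq_iff_eq_mul.1 (Finset.mem_singleton.1 hk')

theorem conjSlice_regularRep_tau (f : C(X, ℂ)) :
    θ.conjSlice (regularRep (θ.ofSlices (fun _ => f) {1})) = θ.tau f := by
  refine conjSlice_regularRep_eq fun ξ g x => ?_
  change θ.tauLinear f (θ.sliceLinear ξ) g x = _
  by_cases hx : g ∈ θ.Q x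
  · rw [zeroExt_conv_ofSlices_singleton f 1 ξ hx, tauLinear_apply, ContinuousMap.mul_apply,
      translate_of_mem hx, mul_one, sliceLinear_apply]
  · rw [zeroExt_of_notMem _ (x, g) hx]
    exact apply_mem _ g x hx

theorem conjSlice_regularRep_v (h : G) :
    θ.conjSlice (regularRep (θ.ofSlices (fun _ => 1) {h})) = θ.v h := by
  refine conjSlice_regularRep_eq fun ξ g x => ?_
  change θ.vLinear h (θ.sliceLinear ξ) g x = _
  by_cases hx : g ∈ θ.Q x
  · rw [zeroExt_conv_ofSlices_singleton 1 h ξ hx, vLinear_apply, restrict_of_mem hx,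
      sliceLinear_apply, ContinuousMap.one_apply, one_mul]
  · rw [zeroExt_of_notMem _ (x, g) hx]
    exact apply_mem _ g x hx

/-! ### The isomorphism of the reduced algebras -/

/-- Conjugation by `sliceUnitary` as an isomorphism of the reduced groupoid C⋆-algebra with the
reduced partial crossed product. -/
def reducedEquiv (θ : InjectiveAction P X) :
    θ.reducedGroupoidCStar ≃⋆ₐ[ℂ] θ.reducedPartialCrossedProduct :=
  Adjointable.cstarGeneratedEquiv θ.conjSlice continuous_conjSlice continuous_conjSlice_symm
    (by
      rintro _ ⟨f, rfl⟩
      rw [conjSlice_regularRep]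
      -- The image of π̃(f) is already in the algebraic span of products of generators.
      refine sum_mem fun k _ => mul_mem ?_ ?_
      · exact NonUnitalStarSubalgebra.le_topologicalClosure _
          (NonUnitalStarAlgebra.subset_adjoin ℂ _ (Or.inl ⟨_, rfl⟩))
      · exact NonUnitalStarSubalgebra.le_topologicalClosure _
          (NonUnitalStarAlgebra.subset_adjoin ℂ _ (Or.inr ⟨_, rfl⟩)))
    (by
      have key : ∀ f, regularRep f ∈ θ.reducedGroupoidCStar := fun f =>
        NonUnitalStarSubalgebra.le_topologicalClosure _
          (NonUnitalStarAlgebra.subset_adjoin ℂ _ ⟨f, rfl⟩)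
      rintro _ (⟨f, rfl⟩ | ⟨h, rfl⟩)
      -- Each generator of the crossed product is exactly the image of some π̃(f), so no
      -- approximation is needed.
      · rw [← conjSlice_regularRep_tau, StarAlgEquiv.symm_apply_apply]
        exact key _
      · rw [← conjSlice_regularRep_v, StarAlgEquiv.symm_apply_apply]
        exact key _)

end InjectiveAction

end

theorem theorem2p10 {G X : Type*} [Group G] [Countable G] [TopologicalSpace G] [DiscreteTopology G]
    [TopologicalSpace X] [CompactSpace X] [T2Space X] [SecondCountableTopology X]
    (P : Submonoid G) [IsRightOre P] (θ : InjectiveAction P X) :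
    ∃ (Φ : θ.L2 ≃ₗ[C(X, ℂ)] θ.PartialL2)
      (Ψ : θ.reducedGroupoidCStar ≃⋆ₐ[ℂ] θ.reducedPartialCrossedProduct),
      -- `Φ` is a unitary of Hilbert `C(X)`-modules
      (∀ ξ η : θ.L2, inner C(X, ℂ) (Φ ξ) (Φ η) = inner C(X, ℂ) ξ η) ∧
      -- on `C_c(X ⋊ P)` it is given by `Φ(η)(g)(x) = η(x, g)` on `X_g` and zero elsewhere
      (∀ (η : C_c(θ.TransGroupoid, ℂ)) (g : G) (x : X),
        Φ (InjectiveAction.CcL2.of θ η : θ.L2) g x = θ.zeroExt η (x, g)) ∧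
      -- `Ψ(T) = Φ T Φ*`
      ∀ (T : θ.reducedGroupoidCStar) (ζ : θ.L2), (Ψ T).1 (Φ ζ) = Φ (T.1 ζ) :=
  ⟨θ.sliceModuleEquiv, θ.reducedEquiv, InjectiveAction.inner_sliceUnitary,
    fun η g x => congrArg (fun ξ : θ.PartialL2 => ξ g x)
      (InjectiveAction.sliceUnitary_coe (InjectiveAction.CcL2.of θ η)),
    -- As Φ is bijective and preserves inner products, Φ* = Φ⁻¹, so this intertwining relation is
    -- the formula Ψ(T) = Φ T Φ*.
    fun T ζ => InjectiveAction.conjSlice_apply T.1 ζ⟩
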